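/- Let $\sigma>0$ and $\lambda>0$, and let $N=(N_t)_{t\in\mathbb R}$ be a two-sided Poisson process of rate $\lambda$ on its canonical space: $\Omega$ is the set of nondecreasing, right-continuous functions $\omega:\mathbb R\to\mathbb Z$ with $\omega(0)=0$, with the $\sigma$-algebra generated by the evaluations, $N_t(\omega)=\omega(t)$, and $\mathbb P$ is the probability measure on $\Omega$ under which $N$ has independent increments and $N_t-N_s$ is Poisson distributed with parameter $\lambda(t-s)$ for all $s\le t$. Let $(\theta_t\omega)(s)=\omega(s+t)-\omega(t)$ for $s,t\in\mathbb R$. Consider the one-dimensional SDE $$\mathrm dX_t=(X_t-X_t^3)\,\mathrm dt+\sigma\,\mathrm dN_t .$$ **Theorem.** For every $\omega\in\Omega$ and $x\in\mathbb R$ the equation $X_t=x+\int_0^t(X_s-X_s^3)\,\mathrm ds+\sigma N_t(\omega)$, $t\ge 0$, has exactly one solution $\phi_t(\omega,x)$. Over $(\Omega,\mathbb P,\theta)$, which is an ergodic metric dynamical system, $\phi$ is a random dynamical system: it is jointly measurable, continuous in $x$, and satisfies $\phi_0(\omega,x)=x$ and $\phi_{t+s}(\omega,x)=\phi_t(\theta_s\omega,\phi_s(\omega,x))$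 for all $s,t\ge0$, $\omega\in\Omega$, $x\in\mathbb R$. Synchronization occurs for $\phi$: there is a weak attractor $A$ such that $A(\omega)$ is a singleton for $\mathbb P$-almost every $\omega$. Here a weak attractor is a random nonempty compact set $A(\omega)\subset\mathbb R$ such that, almost surely, $\phi_t(\omega,A(\omega))=A(\theta_t\omega)$ for all $t\ge0$, and such that for every compact $B\subset\mathbb R$ $$\lim_{t\to\infty}\ \sup_{x\in B} d\big(\phi_t(\theta_{-t}\omega,x),A(\omega)\big)=0\quad\text{in probability.}$$ -/

import Mathlib

open MeasureTheory ProbabilityTheory Filter Topology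
open scoped NNReal ENNReal

/-! ### Random dynamical systems and weak attractors -/

section RDS

variable {Ω E : Type*} [MeasurableSpace Ω] [MetricSpace E] [MeasurableSpace E]

/-- `(Ω, P, θ)` is an ergodic metric dynamical system over the time group `ℝ`. -/
structure IsErgodicMDS (P : Measure Ω) (θ : ℝ → Ω → Ω) : Prop where
  isProbabilityMeasure : IsProbabilityMeasure P
  measurable : Measurable (fun p : ℝ × Ω => θ p.1 p.2)
  zero : ∀ ω, θ 0 ω = ω
  add : ∀ s t ω, θ (s + t) ω = θ s (θ t ω)
  measurePreserving : ∀ t, MeasurePreserving (θ t) P P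
  ergodic : ∀ B : Set Ω, MeasurableSet B → (∀ t, θ t ⁻¹' B =ᵐ[P] B) → P B = 0 ∨ P B = 1

/-- `φ` is a random dynamical system (a continuous, jointly measurable perfect cocycle with one-sided
time) over the ergodic metric dynamical system `(Ω, P, θ)`. -/
structure IsRDS (P : Measure Ω) (θ : ℝ → Ω → Ω) (φ : ℝ≥0 → Ω → E → E) : Prop where
  base : IsErgodicMDS P θ
  measurable : Measurable (fun p : ℝ≥0 × Ω × E => φ p.1 p.2.1 p.2.2)
  zero : ∀ ω x, φ 0 ω x = x
  cocycle : ∀ (s t : ℝ≥0) ω x, φ (t + s) ω x = φ t (θ s ω) (φ s ω x)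
  continuous : ∀ t ω, Continuous (φ t ω)

/-- `A` is a random (nonempty) compact set. -/
structure IsRandomCompactSet (A : Ω → Set E) : Prop where
  nonempty : ∀ ω, (A ω).Nonempty
  isCompact : ∀ ω, IsCompact (A ω)
  measurable : ∀ x : E, Measurable (fun ω => Metric.infEDist x (A ω))

/-- `A` is a weak attractor of `φ`: an invariant random compact set such that, for every compact
`B`, `sup_{x ∈ B} d(φ_t(θ_{-t} ω, x), A(ω)) → 0` in probability as `t → ∞`. -/
structure IsWeakAttractor (P : Measure Ω) (θ : ℝ → Ω → Ω) (φ : ℝ≥0 → Ω → E → E)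
    (A : Ω → Set E) : Prop where
  isRandomCompactSet : IsRandomCompactSet A
  invariant : ∀ᵐ ω ∂P, ∀ t : ℝ≥0, φ t ω '' A ω = A (θ t ω)
  attracts : ∀ B : Set E, IsCompact B → ∀ ε : ℝ≥0∞, 0 < ε →
    Tendsto (fun t : ℝ≥0 =>
      P {ω | ε ≤ ⨆ x ∈ B, Metric.infEDist (φ t (θ (-(t : ℝ)) ω) x) (A ω)}) atTop (𝓝 0)

/-- Synchronization occurs: there is a weak attractor which is almost surely a singleton. -/
def SynchronizationOccurs (P : Measure Ω) (θ : ℝ → Ω → Ω) (φ : ℝ≥0 → Ω → E → E) : Prop :=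
  ∃ A : Ω → Set E, IsWeakAttractor P θ φ A ∧ ∀ᵐ ω ∂P, ∃ a : E, A ω = {a}

end RDS

/-! ### The canonical two-sided Poisson process -/

/-- The space of two-sided counting paths: nondecreasing, right-continuous (for the discrete topology
of `ℤ`), integer-valued functions on `ℝ` that vanish at `0`. It carries the `σ`-algebra generated by
the evaluations. -/
abbrev CountingPath : Type :=
  {ω : ℝ → ℤ // Monotone ω ∧ (∀ t, ContinuousWithinAt ω (Set.Ici t) t) ∧ ω 0 = 0}

/-- The shift `(θ_t ω)(s) = ω(s + t) - ω(t)`. -/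
def CountingPath.shift (t : ℝ) (ω : CountingPath) : CountingPath :=
  ⟨fun s => ω.1 (s + t) - ω.1 t, by
    obtain ⟨ω, hm, hc, h0⟩ := ω
    refine ⟨fun a b hab => sub_le_sub_right (hm (by linarith)) _, fun s => ?_, by simp⟩
    refine ContinuousWithinAt.sub ?_ continuousWithinAt_const
    refine (hc (s + t)).comp (t := Set.Ici (s + t)) (f := fun u : ℝ => u + t)
      (by fun_prop) ?_
    intro u hu
    simpa using hu⟩

/-- `P` is the law on path space of the two-sided Poisson process with the given rate: the
coordinate process has independent increments, and the increment over `(s, t]` is Poisson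
distributed with parameter `rate * (t - s)`. -/
structure IsPoissonLaw (rate : ℝ≥0) (P : Measure CountingPath) : Prop where
  isProbabilityMeasure : IsProbabilityMeasure P
  indep : HasIndepIncrements (fun (t : ℝ) (ω : CountingPath) => ω.1 t) P
  law : ∀ s t : ℝ, s ≤ t → HasLaw (fun ω : CountingPath => ω.1 t - ω.1 s)
    ((poissonMeasure (rate * (t - s).toNNReal)).map (Nat.cast : ℕ → ℤ)) P

/-! ### The stochastic differential equation `dX = (X - X³) dt + σ dN` -/

/-- `X` solves `dX = (X - X³) dt + σ dω` on `[0, ∞)` with `X 0 = x`, i.e.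
`X_t = x + ∫_0^t (X_s - X_s³) ds + σ ω(t)`. As the noise is additive, the stochastic integral is
`σ (ω(t) - ω(0)) = σ ω(t)`, path by path; the equation forces `X` to be càdlàg. -/
def IsSolution (σ : ℝ) (ω : CountingPath) (x : ℝ) (X : ℝ≥0 → ℝ) : Prop :=
  ∀ t : ℝ≥0,
    IntervalIntegrable (fun s : ℝ => X s.toNNReal - X s.toNNReal ^ 3) volume 0 t ∧
    X t = x + (∫ s in (0 : ℝ)..t, (X s.toNNReal - X s.toNNReal ^ 3)) + σ * (ω.1 t : ℝ)

/-- `φ` is the solution flow of the equation: `t ↦ φ_t(ω, x)` is a solution driven by `ω` and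
started at `x`, for every `ω` and `x`. -/
def IsSolutionFlow (σ : ℝ) (φ : ℝ≥0 → CountingPath → ℝ → ℝ) : Prop :=
  ∀ ω x, IsSolution σ ω x (fun t => φ t ω x)

/-! ### Counting paths -/

namespace CountingPath

/-! On the line every solution map is nondecreasing in its starting point, so the image of all of
`ℝ` under the flow from time `-t` to `0` lies between a lower and an upper envelope
(`lowerPullback`, `upperPullback`). The cubic drift brings solutions down from infinity in a way
that does not depend on the start (`jumpFlow_le`, `le_jumpFlow`), so the envelopes are finite for `t
> 0`. They close in on each other as `t` grows, and synchronization says that the gap vanishes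
almost surely.

A positive gap in the limit would leave some rational level `c` between the envelopes forever. Let
`M` bound, uniformly in the level, the probability that the envelopes at time `t` straddle it. With
probability at least `1 - q`, uniformly in `c`, one further unit of noise sends the whole line to
one side of `c` (`exists_splitting`): no jump does so for `c ≥ 2`, a late burst of jumps for `c <
2`. Otherwise the preimage of `(-∞, c]` is still empty, everything, or a half-line `(-∞, h]`, where
`h` depends only on the new noise and is therefore independent of the old envelopes. So straddling
after one more unit has probability at most `q * M` (`measure_crossing_add_one_le`), and it decays
geometrically.

The flow itself is built from the closed-form solution of `y' = y - y³` between jumps, which makes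
measurability, continuity and monotonicity explicit. Uniqueness, the cocycle identity and locality
all come from uniqueness for the random ODE solved by `X - σ N`. Ergodicity follows from
independence of the path on disjoint windows. -/

lemma measurable_eval (t : ℝ) : Measurable (fun ω : CountingPath => ω.1 t) :=
  (measurable_pi_apply t).comp measurable_subtype_coe

lemma measurable_increment (s t : ℝ) : Measurable (fun ω : CountingPath => ω.1 t - ω.1 s) :=
  (measurable_eval t).sub (measurable_eval s)

lemma measurable_of_eval {α : Type*} [MeasurableSpace α] {f : α → CountingPath}
    (h : ∀ t, Measurable fun a => (f a).1 t) : Measurable f :=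
  (measurable_pi_lambda (fun a => (f a).1) h).subtype_mk (h := fun a => (f a).2)

lemma exists_eq_right (ω : CountingPath) (t : ℝ) :
    ∃ u > t, ∀ s, t ≤ s → s < u → ω.1 s = ω.1 t := by
  have h : ∀ᶠ s in 𝓝[≥] t, ω.1 s = ω.1 t :=
    (ω.2.2.1 t) (by simp : {ω.1 t} ∈ 𝓝 (ω.1 t))
  obtain ⟨u, hu, hs⟩ := mem_nhdsGE_iff_exists_Ico_subset.1 h
  exact ⟨u, hu, fun s h1 h2 => hs ⟨h1, h2⟩⟩

/-- The integer values before `t` are bounded by `ω t`, so their supremum is attained; monotonicity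
freezes the path from there up to `t`. -/
lemma exists_eq_left (ω : CountingPath) (t : ℝ) :
    ∃ s < t, ∀ u, s ≤ u → u < t → ω.1 u = ω.1 s := by
  have hne : (ω.1 '' Set.Iio t).Nonempty := ⟨_, t - 1, by simp, rfl⟩
  have hbdd : BddAbove (ω.1 '' Set.Iio t) := by
    refine ⟨ω.1 t, ?_⟩
    rintro _ ⟨s, hs, rfl⟩
    exact ω.2.1 (le_of_lt hs)
  obtain ⟨s, hs, hsup⟩ := Int.csSup_mem hne hbdd
  refine ⟨s, hs, fun u h1 h2 => le_antisymm ?_ (ω.2.1 h1)⟩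
  rw [hsup]
  exact le_csSup hbdd ⟨u, h2, rfl⟩

lemma nonneg (ω : CountingPath) {t : ℝ} (ht : 0 ≤ t) : 0 ≤ ω.1 t :=
  ω.2.2.2.symm.le.trans (ω.2.1 ht)

/-- By right-continuity, `ω t < k` is witnessed at some rational time after `t`; monotonicity gives
the converse. -/
lemma measurable_uncurry_eval : Measurable (fun p : ℝ × CountingPath => p.2.1 p.1) := by
  refine measurable_of_Iio fun k => ?_
  have : (fun p : ℝ × CountingPath => p.2.1 p.1) ⁻¹' Set.Iio k =
      ⋃ q : ℚ, {p : ℝ × CountingPath | p.1 < q} ∩ {p | p.2.1 q < k} := by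
    ext ⟨t, ω⟩
    simp only [Set.mem_preimage, Set.mem_Iio, Set.mem_iUnion, Set.mem_inter_iff, Set.mem_ofPred_eq]
    constructor
    · intro h
      obtain ⟨u, hu, hs⟩ := ω.exists_eq_right t
      obtain ⟨q, hq1, hq2⟩ := exists_rat_btwn hu
      exact ⟨q, hq1, by rwa [hs q hq1.le hq2]⟩
    · rintro ⟨q, h1, h2⟩
      exact (ω.2.1 h1.le).trans_lt h2
  rw [this]
  refine MeasurableSet.iUnion fun q => MeasurableSet.inter ?_ ?_
  · exact measurableSet_lt measurable_fst measurable_const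
  · exact ((measurable_eval q).comp measurable_snd) measurableSet_Iio

lemma measurable_uncurry_shift : Measurable (fun p : ℝ × CountingPath => shift p.1 p.2) := by
  refine measurable_of_eval fun s => ?_
  exact (measurable_uncurry_eval.comp
    ((measurable_const.add measurable_fst).prodMk measurable_snd)).sub measurable_uncurry_eval

lemma measurable_shift (t : ℝ) : Measurable (shift t) :=
  measurable_uncurry_shift.comp (measurable_const.prodMk measurable_id)

lemma shift_zero (ω : CountingPath) : shift 0 ω = ω := by
  apply Subtype.ext; funext s
  simp [shift, ω.2.2.2]

lemma shift_add (s t : ℝ) (ω : CountingPath) : shift (s + t) ω = shift s (shift t ω) := by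
  apply Subtype.ext; funext u
  simp [shift, add_assoc]

/-- Composition of a path with a monotone continuous time change that fixes `0`. -/
def timeChange (g : ℝ → ℝ) (hm : Monotone g) (hc : Continuous g) (h0 : g 0 = 0)
    (ω : CountingPath) : CountingPath :=
  ⟨fun s => ω.1 (g s), ω.2.1.comp hm, fun t =>
    ContinuousWithinAt.comp (t := Set.Ici (g t)) (ω.2.2.1 (g t)) hc.continuousWithinAt
      (fun _ hs => hm hs), (congrArg ω.1 h0).trans ω.2.2.2⟩

lemma measurable_timeChange (g : ℝ → ℝ) (hm : Monotone g) (hc : Continuous g) (h0 : g 0 = 0) :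
    Measurable (timeChange g hm hc h0) :=
  measurable_of_eval fun s => measurable_eval (g s)

/-- The path frozen at time `0` on the positive half-line. -/
def past : CountingPath → CountingPath :=
  timeChange (fun s => min s 0) (fun _ _ h => min_le_min_right _ h) (by fun_prop) (by simp)

/-- The path set to zero on the negative half-line. -/
def future : CountingPath → CountingPath :=
  timeChange (fun s => max s 0) (fun _ _ h => max_le_max_right _ h) (by fun_prop) (by simp)

/-- The path frozen outside of `[-n, n]`. -/
def window (n : ℕ) : CountingPath → CountingPath :=
  timeChange (fun s => max (-(n : ℝ)) (min s n))
    (fun _ _ h => max_le_max_left _ (min_le_min_right _ h)) (by fun_prop) (by simp)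

lemma measurable_past : Measurable past := measurable_timeChange _ _ _ _

lemma measurable_future : Measurable future := measurable_timeChange _ _ _ _

lemma measurable_window (n : ℕ) : Measurable (window n) := measurable_timeChange _ _ _ _

lemma past_apply (ω : CountingPath) (s : ℝ) : (past ω).1 s = ω.1 (min s 0) := rfl

lemma future_apply (ω : CountingPath) (s : ℝ) : (future ω).1 s = ω.1 (max s 0) := rfl

lemma window_apply (n : ℕ) (ω : CountingPath) (s : ℝ) :
    (window n ω).1 s = ω.1 (max (-(n : ℝ)) (min s n)) := rfl

lemma shift_apply (t : ℝ) (ω : CountingPath) (s : ℝ) : (shift t ω).1 s = ω.1 (s + t) - ω.1 t := rfl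

/-- Cutting at time `n`: the path on `[-n, n]` is read off from the past of the shifted path, and
its increments on `[n, 3n]` from the future. -/
lemma window_eq_past (n : ℕ) (ω : CountingPath) :
    window n ω = window n (shift (-(n : ℝ)) (past (shift n ω))) := by
  apply Subtype.ext; funext s
  have hn : (0 : ℝ) ≤ n := n.cast_nonneg
  simp only [window_apply, shift_apply, past_apply]
  set c := max (-(n : ℝ)) (min s n)
  have hc : c ≤ n := max_le (by linarith) (min_le_right _ _)
  rw [min_eq_left (by linarith : c + -(n : ℝ) ≤ 0), min_eq_left (by linarith : -(n : ℝ) ≤ 0)]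
  simp [ω.2.2.2]

lemma window_shift_eq_future (n : ℕ) (ω : CountingPath) :
    window n (shift (2 * n) ω) = window n (shift n (future (shift n ω))) := by
  apply Subtype.ext; funext s
  have hn : (0 : ℝ) ≤ n := n.cast_nonneg
  simp only [window_apply, shift_apply, future_apply]
  set c := max (-(n : ℝ)) (min s n)
  have hc : -(n : ℝ) ≤ c := le_max_left _ _
  rw [max_eq_left (by linarith : 0 ≤ c + (n : ℝ)), max_eq_left hn]
  simp [add_assoc, two_mul]

lemma window_window {m n : ℕ} (h : m ≤ n) (ω : CountingPath) :
    window m (window n ω) = window m ω := by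
  apply Subtype.ext; funext s
  have hm : (0 : ℝ) ≤ m := m.cast_nonneg
  have hmn : (m : ℝ) ≤ n := by exact_mod_cast h
  simp only [window_apply]
  set c := max (-(m : ℝ)) (min s m)
  have h1 : c ≤ m := max_le (by linarith) (min_le_right _ _)
  have h2 : -(m : ℝ) ≤ c := le_max_left _ _
  rw [min_eq_left (by linarith), max_eq_right (by linarith)]

end CountingPath

/-! ### The law of the Poisson process -/

/-- Independence of increments is applied along infinite monotone sequences of times; the finite
list is continued by repeating its last element. -/
lemma exists_monotone_enumeration (K : Finset ℝ) :
    ∃ (n : ℕ) (t : ℕ → ℝ), Monotone t ∧ ∀ x ∈ K, ∃ i < n, t i = x := by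
  obtain rfl | hK := K.eq_empty_or_nonempty
  · exact ⟨0, fun _ => 0, monotone_const, by simp⟩
  have hc : 0 < K.card := hK.card_pos
  refine ⟨K.card, fun i => K.orderEmbOfFin rfl ⟨min i (K.card - 1), by omega⟩, ?_, ?_⟩
  · intro i j hij
    refine (K.orderEmbOfFin rfl).monotone ?_
    simp only [Fin.mk_le_mk]; omega
  · intro x hx
    have : x ∈ Set.range (K.orderEmbOfFin rfl) := by simpa using hx
    obtain ⟨i, rfl⟩ := this
    refine ⟨i, i.2, ?_⟩
    have := i.2
    exact congrArg _ (Fin.ext (by simp only; omega))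

namespace IsPoissonLaw

variable {rate : ℝ≥0} {P Q : Measure CountingPath}

lemma map_increments (hP : IsPoissonLaw rate P) {t : ℕ → ℝ} (ht : Monotone t) :
    P.map (fun ω (i : ℕ) => ω.1 (t (i + 1)) - ω.1 (t i)) =
      Measure.infinitePi (fun i => (poissonMeasure (rate * (t (i + 1) - t i).toNNReal)).map
        (Nat.cast : ℕ → ℤ)) := by
  have := hP.isProbabilityMeasure
  have h := hP.indep.nat ht
  rw [iIndepFun_iff_map_fun_eq_infinitePi_map
    (fun i => CountingPath.measurable_increment (t i) (t (i + 1)))] at h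
  rw [h]
  congr 1
  funext i
  exact (hP.law _ _ (ht (Nat.le_succ i))).map_eq

/-- Since paths vanish at `0`, each coordinate is a difference of partial sums of increments, whose
joint law is prescribed. This fixes the finite-dimensional laws and yields shift invariance. -/
lemma unique (hP : IsPoissonLaw rate P) (hQ : IsPoissonLaw rate Q) : P = Q := by
  have := hP.isProbabilityMeasure
  have := hQ.isProbabilityMeasure
  have key : ∀ I : Finset ℝ, P.map (fun ω => I.restrict ω.1) = Q.map (fun ω => I.restrict ω.1) := by
    intro I
    obtain ⟨n, t, ht, hK⟩ := exists_monotone_enumeration (insert 0 I)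
    obtain ⟨m, -, hm⟩ := hK 0 (by simp)
    choose! idx hidx htidx using fun x (hx : x ∈ I) => hK x (Finset.mem_insert_of_mem hx)
    let G : (ℕ → ℤ) → (I → ℤ) := fun v x =>
      ∑ i ∈ Finset.range (idx x), v i - ∑ i ∈ Finset.range m, v i
    have hG : Measurable G := by fun_prop
    have hinc : Measurable (fun (ω : CountingPath) (i : ℕ) => ω.1 (t (i + 1)) - ω.1 (t i)) :=
      measurable_pi_lambda _ fun i => CountingPath.measurable_increment _ _
    have hfac : (fun ω : CountingPath => I.restrict ω.1) =
        G ∘ (fun (ω : CountingPath) (i : ℕ) => ω.1 (t (i + 1)) - ω.1 (t i)) := by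
      funext ω x
      simp only [G, Function.comp, Finset.restrict]
      rw [Finset.sum_range_sub (fun i => ω.1 (t i)), Finset.sum_range_sub (fun i => ω.1 (t i)), hm,
        htidx x x.2, ω.2.2.2]
      ring
    rw [hfac, ← Measure.map_map hG hinc, ← Measure.map_map hG hinc, hP.map_increments ht,
      hQ.map_increments ht]
  have hmap : P.map Subtype.val = Q.map Subtype.val := by
    have : IsProbabilityMeasure (Q.map (Subtype.val : CountingPath → ℝ → ℤ)) :=
      Measure.isProbabilityMeasure_map measurable_subtype_coe.aemeasurable
    refine IsProjectiveLimit.unique (P := fun I => (Q.map Subtype.val).map I.restrict)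
      (fun I => ?_) (fun I => rfl)
    simp only [Measure.map_map (Finset.measurable_restrict I) measurable_subtype_coe]
    exact key I
  ext s hs
  obtain ⟨s', hs', rfl⟩ := hs
  rw [← Measure.map_apply measurable_subtype_coe hs', hmap,
    Measure.map_apply measurable_subtype_coe hs']

lemma map_shift (hP : IsPoissonLaw rate P) (t : ℝ) :
    IsPoissonLaw rate (P.map (CountingPath.shift t)) := by
  have := hP.isProbabilityMeasure
  have hm := CountingPath.measurable_shift t
  refine ⟨Measure.isProbabilityMeasure_map hm.aemeasurable, ?_, fun s u hsu => ?_⟩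
  · intro n τ hτ
    have h := hP.indep n (fun i => τ i + t) (fun i j hij => by simpa using hτ hij)
    rw [iIndepFun_iff_measure_inter_preimage_eq_mul] at h ⊢
    intro S sets hsets
    have hmeas : ∀ i ∈ S, MeasurableSet
        ((fun ω : CountingPath => ω.1 (τ i.succ) - ω.1 (τ i.castSucc)) ⁻¹' sets i) :=
      fun i hi => CountingPath.measurable_increment _ _ (hsets i hi)
    rw [Measure.map_apply hm (Finset.measurableSet_biInter S hmeas),
      Finset.prod_congr rfl fun i hi => Measure.map_apply hm (hmeas i hi)]
    convert h S hsets using 2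
    · simp only [Set.preimage_iInter]
      ext ω
      simp [CountingPath.shift_apply]
    · congr 1
      ext ω
      simp [CountingPath.shift_apply]
  · have h := (hP.law (s + t) (u + t) (by linarith)).map_eq
    rw [show u + t - (s + t) = u - s by ring] at h
    refine ⟨(CountingPath.measurable_increment _ _).aemeasurable, ?_⟩
    rw [Measure.map_map (CountingPath.measurable_increment s u) hm, ← h]
    congr 1
    funext ω
    simp [CountingPath.shift_apply]

lemma measurePreserving_shift (hP : IsPoissonLaw rate P) (t : ℝ) :
    MeasurePreserving (CountingPath.shift t) P P :=
  ⟨CountingPath.measurable_shift t, (hP.map_shift t).unique hP⟩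

/-! ### Independence of past and future -/

/-- Along a monotone list of times with `0` at index `m`, past coordinates use only increments of
index below `m`, and future coordinates only the others. -/
lemma indepFun_past_future (hP : IsPoissonLaw rate P) :
    IndepFun CountingPath.past CountingPath.future P := by
  have := hP.isProbabilityMeasure
  have key : IndepFun (fun ω s => (CountingPath.past ω).1 s)
      (fun ω s => (CountingPath.future ω).1 s) P := by
    refine IndepFun.process_indepFun_process (X := fun s ω => (CountingPath.past ω).1 s)
      (Y := fun s ω => (CountingPath.future ω).1 s)
      (fun s => (CountingPath.measurable_eval s).comp CountingPath.measurable_past)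
      (fun s => (CountingPath.measurable_eval s).comp CountingPath.measurable_future)
      fun I J => ?_
    obtain ⟨n, t, ht, hK⟩ := exists_monotone_enumeration
      (insert 0 (I.image (fun s => min s 0) ∪ J.image (fun s => max s 0)))
    obtain ⟨m, -, hm⟩ := hK 0 (by simp)
    have hI : ∀ s ∈ I, ∃ i ≤ m, t i = min s 0 := by
      intro s hs
      obtain ⟨i, -, hi⟩ := hK (min s 0) (by
        simp only [Finset.mem_insert, Finset.mem_union, Finset.mem_image]
        exact Or.inr (Or.inl ⟨s, hs, rfl⟩))
      -- An index beyond `m` with a nonpositive time has the same time as `m`, so `m` can replace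
      -- it.
      rcases le_total i m with h | h
      · exact ⟨i, h, hi⟩
      · exact ⟨m, le_rfl, le_antisymm (hi ▸ ht h) (hm ▸ min_le_right _ _)⟩
    have hJ : ∀ s ∈ J, ∃ i, m ≤ i ∧ i ≤ max m n ∧ t i = max s 0 := by
      intro s hs
      obtain ⟨i, hin, hi⟩ := hK (max s 0) (by
        simp only [Finset.mem_insert, Finset.mem_union, Finset.mem_image]
        exact Or.inr (Or.inr ⟨s, hs, rfl⟩))
      rcases le_total m i with h | h
      · exact ⟨i, h, hin.le.trans (le_max_right _ _), hi⟩
      · exact ⟨m, le_rfl, le_max_left _ _, le_antisymm (hm ▸ le_max_right _ _) (hi ▸ ht h)⟩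
    choose! iI hIm hIt using hI
    choose! iJ hmJ hJn hJt using hJ
    have hind := (hP.indep.nat ht).indepFun_finset (Finset.range m) (Finset.Ico m (max m n))
      (by
        rw [Finset.range_eq_Ico]
        exact Finset.Ico_disjoint_Ico_consecutive 0 m _)
      (fun i => (CountingPath.measurable_eval _).sub (CountingPath.measurable_eval _))
    let F : (Finset.range m → ℤ) → (I → ℤ) := fun v s =>
      -∑ i : Finset.range m, if iI s ≤ i.1 then v i else 0
    let G : (Finset.Ico m (max m n) → ℤ) → (J → ℤ) := fun v s =>
      ∑ i : Finset.Ico m (max m n), if i.1 < iJ s then v i else 0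
    have hF : Measurable F := by
      refine measurable_pi_lambda _ fun s => Measurable.neg ?_
      refine Finset.measurable_sum _ fun i _ => ?_
      split_ifs <;> fun_prop
    have hG : Measurable G := by
      refine measurable_pi_lambda _ fun s => ?_
      refine Finset.measurable_sum _ fun i _ => ?_
      split_ifs <;> fun_prop
    have := hind.comp hF hG
    convert this using 1
    · funext ω s
      simp only [F, Function.comp, CountingPath.past_apply]
      rw [Finset.sum_coe_sort (Finset.range m)
        (fun i => if iI s ≤ i then ω.1 (t (i + 1)) - ω.1 (t i) else 0), ← Finset.sum_filter]
      have : (Finset.range m).filter (fun i => iI s ≤ i) = Finset.Ico (iI s) m := by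
        ext i; simp [and_comm]
      rw [this, Finset.sum_Ico_sub (fun i => ω.1 (t i)) (hIm s s.2), hm, ω.2.2.2, hIt s s.2]
      ring
    · funext ω s
      simp only [G, Function.comp, CountingPath.future_apply]
      rw [Finset.sum_coe_sort (Finset.Ico m (max m n))
        (fun i => if i < iJ s then ω.1 (t (i + 1)) - ω.1 (t i) else 0), ← Finset.sum_filter]
      have : (Finset.Ico m (max m n)).filter (fun i => i < iJ s) = Finset.Ico m (iJ s) := by
        ext i
        have := hJn s s.2
        simp only [Finset.mem_filter, Finset.mem_Ico]
        omega
      rw [this, Finset.sum_Ico_sub (fun i => ω.1 (t i)) (hmJ s s.2), hm, ω.2.2.2, hJt s s.2]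
      ring
  intro s u hs hu
  obtain ⟨_, ⟨s', hs', rfl⟩, rfl⟩ := hs
  obtain ⟨_, ⟨u', hu', rfl⟩, rfl⟩ := hu
  exact key _ _ ⟨s', hs', rfl⟩ ⟨u', hu', rfl⟩

lemma indepFun_window (hP : IsPoissonLaw rate P) (n : ℕ) :
    IndepFun (CountingPath.window n)
      (fun ω => CountingPath.window n (CountingPath.shift (2 * n) ω)) P := by
  have h1 : IndepFun (fun ω => CountingPath.past (CountingPath.shift n ω))
      (fun ω => CountingPath.future (CountingPath.shift n ω)) P := by
    have hmp := hP.measurePreserving_shift n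
    have hpf := hP.indepFun_past_future
    rw [indepFun_iff_measure_inter_preimage_eq_mul] at hpf ⊢
    intro A B hA hB
    have hA' := CountingPath.measurable_past hA
    have hB' := CountingPath.measurable_future hB
    have := hpf A B hA hB
    rwa [← hmp.measure_preimage (hA'.inter hB').nullMeasurableSet,
      ← hmp.measure_preimage hA'.nullMeasurableSet,
      ← hmp.measure_preimage hB'.nullMeasurableSet] at this
  have h2 := h1.comp
    ((CountingPath.measurable_window n).comp (CountingPath.measurable_shift (-(n : ℝ))))
    ((CountingPath.measurable_window n).comp (CountingPath.measurable_shift n))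
  convert h2 using 1
  · funext ω; exact CountingPath.window_eq_past n ω
  · funext ω; exact CountingPath.window_shift_eq_future n ω

end IsPoissonLaw

/-! ### Ergodicity of the shift -/

/-- The `σ`-algebra of the path observed on `[-n, n]`. -/
abbrev CountingPath.windowAlgebra (n : ℕ) : MeasurableSpace CountingPath :=
  MeasurableSpace.comap (window n) inferInstance

lemma CountingPath.windowAlgebra_mono : Monotone windowAlgebra := by
  rintro m n hmn _ ⟨s, hs, rfl⟩
  refine ⟨window m ⁻¹' s, measurable_window m hs, ?_⟩
  ext ω
  simp [window_window hmn]

lemma CountingPath.iSup_windowAlgebra :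
    (⨆ n : ℕ, windowAlgebra n) = Subtype.instMeasurableSpace := by
  refine le_antisymm (iSup_le fun n => (measurable_window n).comap_le) ?_
  have h : ∀ t : ℝ, Measurable[⨆ n : ℕ, windowAlgebra n]
      (fun ω : CountingPath => ω.1 t) := by
    intro t
    obtain ⟨n, hn⟩ := exists_nat_ge |t|
    have : (fun ω : CountingPath => ω.1 t) = (fun ω => ω.1 t) ∘ window n := by
      funext ω
      rw [Function.comp, window_apply, min_eq_left ((le_abs_self t).trans hn),
        max_eq_right (by linarith [neg_abs_le t])]
    rw [this]
    refine (measurable_eval t).comp (Measurable.mono (comap_measurable (window n)) ?_ le_rfl)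
    exact le_iSup windowAlgebra n
  have := @measurable_of_eval CountingPath (⨆ n : ℕ, windowAlgebra n) id h
  intro s hs
  exact this hs

lemma CountingPath.exists_window_approx (P : Measure CountingPath) [IsProbabilityMeasure P]
    {B : Set CountingPath} (hB : MeasurableSet B) {ε : ℝ} (hε : 0 < ε) :
    ∃ (n : ℕ) (S : Set CountingPath), MeasurableSet S ∧ P.real (symmDiff B (window n ⁻¹' S)) < ε := by
  have hm := windowAlgebra_mono
  have halg : IsSetAlgebra (⋃ n, {t | MeasurableSet[windowAlgebra n] t}) := by
    refine ⟨?_, ?_, ?_⟩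
    · simp
    · intro s hs
      simp only [Set.mem_iUnion] at hs ⊢
      obtain ⟨n, hn⟩ := hs
      exact ⟨n, @MeasurableSet.compl _ _ (windowAlgebra n) hn⟩
    · intro s t hs ht
      simp only [Set.mem_iUnion] at hs ht ⊢
      obtain ⟨n, hn⟩ := hs
      obtain ⟨k, hk⟩ := ht
      exact ⟨max n k, @MeasurableSet.union _ (windowAlgebra _) _ _ (hm (le_max_left n k) _ hn)
        (hm (le_max_right n k) _ hk)⟩
  have hdense := Measure.MeasureDense.of_generateFrom_isSetAlgebra_finite P halg (by
    rw [MeasurableSpace.generateFrom_iUnion_measurableSet windowAlgebra]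
    exact iSup_windowAlgebra.symm)
  obtain ⟨C, hC, hBC⟩ := hdense.approx B hB (measure_ne_top _ _) ε hε
  simp only [Set.mem_iUnion] at hC
  obtain ⟨n, S, hS, rfl⟩ := hC
  refine ⟨n, S, hS, ?_⟩
  rw [measureReal_def]
  exact (ENNReal.lt_ofReal_iff_toReal_lt (measure_ne_top _ _)).1 hBC

lemma abs_measureReal_sub_le_symmDiff {Ω : Type*} [MeasurableSpace Ω] (P : Measure Ω)
    [IsFiniteMeasure P] (s t : Set Ω) : |P.real s - P.real t| ≤ P.real (symmDiff s t) := by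
  have h1 : P.real s ≤ P.real t + P.real (symmDiff s t) := by
    refine (measureReal_mono ?_).trans (measureReal_union_le t _)
    intro x hx
    by_cases h : x ∈ t
    · exact Or.inl h
    · exact Or.inr (Or.inl ⟨hx, h⟩)
  have h2 : P.real t ≤ P.real s + P.real (symmDiff s t) := by
    refine (measureReal_mono ?_).trans (measureReal_union_le s _)
    intro x hx
    by_cases h : x ∈ s
    · exact Or.inl h
    · exact Or.inr (Or.inr ⟨hx, h⟩)
  rw [abs_le]; constructor <;> linarith

namespace IsPoissonLaw

variable {rate : ℝ≥0} {P : Measure CountingPath}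

/-- Approximate `B` by a window event `C`. Its shift by `2 * n` is independent of `C` and
approximates `B` by invariance, so `P B` is close to `(P B) ^ 2`. -/
lemma measure_eq_zero_or_one_of_invariant (hP : IsPoissonLaw rate P) {B : Set CountingPath}
    (hB : MeasurableSet B) (hinv : ∀ t, CountingPath.shift t ⁻¹' B =ᵐ[P] B) :
    P B = 0 ∨ P B = 1 := by
  have := hP.isProbabilityMeasure
  -- Replacing the intersection costs `2 * ε`; passing from `(P C) ^ 2` to `(P B) ^ 2` costs another
  -- `2 * ε`.
  have key : ∀ ε : ℝ, 0 < ε → |P.real B - P.real B ^ 2| ≤ 4 * ε := by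
    intro ε hε
    obtain ⟨n, S, hS, hBS⟩ := CountingPath.exists_window_approx P hB hε
    set C := CountingPath.window n ⁻¹' S with hC
    have hCm : MeasurableSet C := CountingPath.measurable_window n hS
    set D := CountingPath.shift (2 * n) ⁻¹' C with hD
    have hmp := hP.measurePreserving_shift (2 * n)
    have hDC : P.real D = P.real C := by
      simp only [measureReal_def, hD, hmp.measure_preimage hCm.nullMeasurableSet]
    have hind : P.real (C ∩ D) = P.real C * P.real D := by
      have := (indepFun_iff_measure_inter_preimage_eq_mul.1 (hP.indepFun_window n)) S S hS hS
      simp only [measureReal_def, ← ENNReal.toReal_mul]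
      exact congrArg _ this
    have hBD : P.real (symmDiff (CountingPath.shift (2 * n) ⁻¹' B) D) < ε := by
      have : symmDiff (CountingPath.shift (2 * n) ⁻¹' B) D =
          CountingPath.shift (2 * n) ⁻¹' (symmDiff B C) := rfl
      rw [this, measureReal_def, hmp.measure_preimage (hB.symmDiff hCm).nullMeasurableSet]
      exact hBS
    have hBB : P.real (B ∩ CountingPath.shift (2 * n) ⁻¹' B) = P.real B := by
      refine measureReal_congr ?_
      have := (ae_eq_refl B).inter (hinv (2 * n))
      rwa [Set.inter_self] at this
    have h1 : |P.real (B ∩ CountingPath.shift (2 * n) ⁻¹' B) - P.real (C ∩ D)| ≤ 2 * ε := by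
      refine (abs_measureReal_sub_le_symmDiff P _ _).trans ?_
      refine (measureReal_mono (s₂ := symmDiff B C ∪
        symmDiff (CountingPath.shift (2 * n) ⁻¹' B) D) ?_).trans
        ((measureReal_union_le _ _).trans (by linarith))
      intro x hx
      simp only [Set.mem_symmDiff, Set.mem_inter_iff, Set.mem_union] at hx ⊢
      tauto
    have h2 := (abs_measureReal_sub_le_symmDiff P B C).trans hBS.le
    rw [hBB, hind, hDC] at h1
    have hb0 : 0 ≤ P.real B := measureReal_nonneg
    have hb1 : P.real B ≤ 1 := measureReal_le_one
    have hc0 : 0 ≤ P.real C := measureReal_nonneg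
    have hc1 : P.real C ≤ 1 := measureReal_le_one
    rw [abs_le] at h1 h2 ⊢
    constructor <;> nlinarith
  have h0 : P.real B - P.real B ^ 2 = 0 := by
    by_contra h
    have hpos := abs_pos.2 h
    have := key (|P.real B - P.real B ^ 2| / 8) (by positivity)
    linarith
  have h1 : P.real B * (1 - P.real B) = 0 := by linarith [h0]
  rcases mul_eq_zero.1 h1 with h | h
  · left; exact (measureReal_eq_zero_iff).1 h
  · right
    have h : P.real B = 1 := by linarith
    rw [measureReal_def] at h
    rw [← ENNReal.ofReal_toReal (measure_ne_top P B), h, ENNReal.ofReal_one]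

lemma isErgodicMDS (hP : IsPoissonLaw rate P) : IsErgodicMDS P CountingPath.shift where
  isProbabilityMeasure := hP.isProbabilityMeasure
  measurable := CountingPath.measurable_uncurry_shift
  zero := CountingPath.shift_zero
  add := CountingPath.shift_add
  measurePreserving := hP.measurePreserving_shift
  ergodic _ hB hinv := hP.measure_eq_zero_or_one_of_invariant hB hinv

end IsPoissonLaw

/-! ### Pathwise reformulation of the equation -/

/-- The drift `x - x³`. -/
def drift (x : ℝ) : ℝ := x - x ^ 3

lemma continuous_drift : Continuous drift := by unfold drift; fun_prop

lemma drift_neg (x : ℝ) : drift (-x) = -drift x := by unfold drift; ring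

lemma abs_drift_sub_le {M u v : ℝ} (hu : |u| ≤ M) (hv : |v| ≤ M) :
    |drift u - drift v| ≤ (1 + 3 * M ^ 2) * |u - v| := by
  have h : drift u - drift v = (1 - (u ^ 2 + u * v + v ^ 2)) * (u - v) := by unfold drift; ring
  rw [h, abs_mul]
  refine mul_le_mul_of_nonneg_right ?_ (abs_nonneg _)
  have h1 : u ^ 2 ≤ M ^ 2 := sq_le_sq' (by linarith [neg_abs_le u]) ((le_abs_self u).trans hu)
  have h2 : v ^ 2 ≤ M ^ 2 := sq_le_sq' (by linarith [neg_abs_le v]) ((le_abs_self v).trans hv)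
  rw [abs_le]
  constructor <;> nlinarith [sq_nonneg (u + v), sq_nonneg (u - v)]

lemma drift_anti {u v : ℝ} (hu : 1 ≤ u) (huv : u ≤ v) : drift v ≤ drift u := by
  unfold drift
  nlinarith [mul_nonneg (sub_nonneg.2 huv) (by nlinarith : 0 ≤ v ^ 2 + u * v + u ^ 2 - 1)]

/-- `Y` solves the random ordinary differential equation `Y' = b(Y + σ ω)`, `Y 0 = x`, where `b` is
the drift; equivalently, `Y + σ ω` solves the stochastic equation. -/
structure IsShiftedSolution (σ : ℝ) (ω : CountingPath) (x : ℝ) (Y : ℝ → ℝ) : Prop where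
  zero : Y 0 = x
  continuousOn : ∀ T, ContinuousOn Y (Set.Icc 0 T)
  hasDerivWithinAt : ∀ t, 0 ≤ t → HasDerivWithinAt Y (drift (Y t + σ * ω.1 t)) (Set.Ici t) t

/-- Subtracting the noise leaves a primitive, hence a continuous function. As the path is constant
just after each time, the integrand is right-continuous and the right derivative exists even at
jumps. -/
lemma IsSolution.isShiftedSolution {σ : ℝ} {ω : CountingPath} {x : ℝ} {X : ℝ≥0 → ℝ}
    (h : IsSolution σ ω x X) :
    IsShiftedSolution σ ω x (fun t => X t.toNNReal - σ * ω.1 t) := by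
  set f : ℝ → ℝ := fun s => X s.toNNReal - X s.toNNReal ^ 3 with hf
  have hint : ∀ t, 0 ≤ t → IntervalIntegrable f volume 0 t := fun t ht => by
    simpa [Real.coe_toNNReal t ht] using (h t.toNNReal).1
  have heq : ∀ t, 0 ≤ t → X t.toNNReal - σ * ω.1 t = x + ∫ s in (0 : ℝ)..t, f s := fun t ht => by
    have := (h t.toNNReal).2
    rw [Real.coe_toNNReal t ht] at this
    rw [this]; ring
  have hcont : ∀ T, ContinuousOn (fun t => X t.toNNReal - σ * ω.1 t) (Set.Icc 0 T) := by
    intro T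
    rcases lt_or_ge T 0 with hT | hT
    · simp [Set.Icc_eq_empty (not_le.2 hT)]
    have h1 := intervalIntegral.continuousOn_primitive_interval' (hint T hT)
      (Set.left_mem_uIcc)
    rw [Set.uIcc_of_le hT] at h1
    exact (continuousOn_const.add h1).congr fun t ht => heq t ht.1
  refine ⟨?_, hcont, fun t ht => ?_⟩
  · rw [heq 0 le_rfl]; simp
  have hright : ContinuousWithinAt f (Set.Ioi t) t := by
    have h1 : ContinuousWithinAt (fun t => X t.toNNReal - σ * ω.1 t) (Set.Ioi t) t :=
      ((hcont (t + 1)) t ⟨ht, by linarith⟩).mono_of_mem_nhdsWithin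
        (mem_of_superset (Ioc_mem_nhdsGT (by linarith : t < t + 1))
          fun s hs => ⟨ht.trans hs.1.le, hs.2⟩)
    obtain ⟨u, hu, hω⟩ := ω.exists_eq_right t
    have h2 : ContinuousWithinAt (fun s => drift (X s.toNNReal - σ * ω.1 s + σ * ω.1 t))
        (Set.Ioi t) t :=
      continuous_drift.continuousAt.comp_continuousWithinAt (h1.add continuousWithinAt_const)
    refine h2.congr_of_eventuallyEq ?_ (by simp [f, drift])
    filter_upwards [Ioo_mem_nhdsGT hu] with s hs
    simp [f, drift, hω s hs.1.le hs.2]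
  have hmeas : StronglyMeasurableAtFilter f (𝓝[>] t) := by
    refine ⟨Set.Ioc 0 (t + 1), mem_of_superset (Ioc_mem_nhdsGT (by linarith : t < t + 1))
      fun s hs => ⟨ht.trans_lt hs.1, hs.2⟩, ?_⟩
    exact (hint (t + 1) (by linarith)).1.aestronglyMeasurable
  have hd := (intervalIntegral.integral_hasDerivWithinAt_right (s := Set.Ici t) (hint t ht)
    hmeas hright).const_add x
  have hft : f t = drift (X t.toNNReal - σ * ω.1 t + σ * ω.1 t) := by simp [f, drift]
  rw [← hft]
  exact hd.congr (fun s hs => heq s (ht.trans hs)) (heq t ht)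

lemma IsShiftedSolution.isSolution {σ : ℝ} {ω : CountingPath} {x : ℝ} {Y : ℝ → ℝ} {X : ℝ≥0 → ℝ}
    (h : IsShiftedSolution σ ω x Y) (hX : ∀ t : ℝ≥0, X t = Y t + σ * ω.1 t) :
    IsSolution σ ω x X := by
  intro t
  have hint : IntervalIntegrable (fun s => drift (Y s + σ * ω.1 s)) volume 0 t := by
    rw [intervalIntegrable_iff_integrableOn_Icc_of_le t.coe_nonneg]
    obtain ⟨C, hC⟩ := isCompact_Icc.exists_bound_of_continuousOn (h.continuousOn t)
    obtain ⟨D, hD⟩ := isCompact_Icc.exists_bound_of_continuousOn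
      (continuous_drift.continuousOn (s := Set.Icc (-(C + |σ| * ω.1 t)) (C + |σ| * ω.1 t)))
    have hω : Measurable fun s : ℝ => (ω.1 s : ℝ) :=
      Monotone.measurable fun a b hab => Int.cast_le.2 (ω.2.1 hab)
    refine Integrable.of_bound (C := D) ?_ ?_
    · exact continuous_drift.comp_aestronglyMeasurable
        (((h.continuousOn t).aestronglyMeasurable measurableSet_Icc).add
          (hω.const_mul σ).aestronglyMeasurable)
    · refine (ae_restrict_iff' measurableSet_Icc).2 (ae_of_all _ fun s hs => hD _ ?_)
      have h1 := hC s hs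
      have h2 : |σ * ω.1 s| ≤ |σ| * ω.1 t := by
        have h3 : (0 : ℝ) ≤ ω.1 s := by exact_mod_cast ω.nonneg hs.1
        have h4 : (ω.1 s : ℝ) ≤ ω.1 t := by exact_mod_cast ω.2.1 hs.2
        rw [abs_mul, abs_of_nonneg h3]
        exact mul_le_mul_of_nonneg_left h4 (abs_nonneg _)
      rw [Real.norm_eq_abs] at h1
      rw [abs_le] at h1 h2
      constructor <;> linarith
  have hcongr : Set.EqOn (fun s => drift (Y s + σ * ω.1 s))
      (fun s : ℝ => X s.toNNReal - X s.toNNReal ^ 3) (Set.uIcc 0 (t : ℝ)) := by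
    intro s hs
    rw [Set.uIcc_of_le t.coe_nonneg] at hs
    simp [drift, hX, Real.coe_toNNReal s hs.1]
  refine ⟨hint.congr ?_, ?_⟩
  · exact hcongr.mono Set.uIoc_subset_uIcc
  · rw [← intervalIntegral.integral_congr hcongr,
      intervalIntegral.integral_eq_sub_of_hasDeriv_right_of_le t.coe_nonneg (h.continuousOn t)
        (fun s hs => (h.hasDerivWithinAt s hs.1.le).mono Set.Ioi_subset_Ici_self) hint, h.zero, hX]
    ring

/-- The drift is only locally Lipschitz, but on `[0, T]` both solutions and the noise stay bounded.
Allowing two paths that agree on `[0, T]` gives locality along with uniqueness. -/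
lemma IsShiftedSolution.eqOn {σ : ℝ} {ω η : CountingPath} {x T : ℝ} {Y Z : ℝ → ℝ}
    (hY : IsShiftedSolution σ ω x Y) (hZ : IsShiftedSolution σ η x Z)
    (hωη : ∀ t ∈ Set.Icc 0 T, ω.1 t = η.1 t) : Set.EqOn Y Z (Set.Icc 0 T) := by
  obtain ⟨C, hC⟩ := isCompact_Icc.exists_bound_of_continuousOn (hY.continuousOn T)
  obtain ⟨D, hD⟩ := isCompact_Icc.exists_bound_of_continuousOn (hZ.continuousOn T)
  have hsub : Set.Ico (0 : ℝ) T ⊆ Set.Icc 0 T := Set.Ico_subset_Icc_self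
  set M := max C D + |σ| * ω.1 T
  refine ODE_solution_unique_of_mem_Icc_right (v := fun t y => drift (y + σ * ω.1 t))
    (s := fun _ => Set.Icc (-max C D) (max C D)) (K := (1 + 3 * M ^ 2).toNNReal)
    (fun t ht => ?_) (hY.continuousOn T) (fun t ht => hY.hasDerivWithinAt t ht.1)
    (fun t ht => abs_le.1 ((hC t (hsub ht)).trans (le_max_left _ _)))
    (hZ.continuousOn T) (fun t ht => ?_)
    (fun t ht => abs_le.1 ((hD t (hsub ht)).trans (le_max_right _ _))) (by rw [hY.zero, hZ.zero])
  · refine LipschitzOnWith.of_dist_le_mul fun u hu v hv => ?_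
    have h2 : |σ * ω.1 t| ≤ |σ| * ω.1 T := by
      have h3 : (0 : ℝ) ≤ ω.1 t := by exact_mod_cast ω.nonneg ht.1
      have h4 : (ω.1 t : ℝ) ≤ ω.1 T := by exact_mod_cast ω.2.1 ht.2.le
      rw [abs_mul, abs_of_nonneg h3]
      exact mul_le_mul_of_nonneg_left h4 (abs_nonneg _)
    have hM : ∀ w ∈ Set.Icc (-max C D) (max C D), |w + σ * ω.1 t| ≤ M := fun w hw =>
      (abs_add_le _ _).trans (add_le_add (abs_le.2 hw) h2)
    rw [Real.coe_toNNReal _ (by positivity), Real.dist_eq, Real.dist_eq]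
    have := abs_drift_sub_le (hM u hu) (hM v hv)
    rwa [add_sub_add_right_eq_sub] at this
  · simp only [hωη t (hsub ht)]
    exact hZ.hasDerivWithinAt t ht.1

lemma IsSolution.eq_of_eqOn {σ : ℝ} {ω η : CountingPath} {x : ℝ} {X X' : ℝ≥0 → ℝ}
    (hX : IsSolution σ ω x X) (hX' : IsSolution σ η x X') {t : ℝ≥0}
    (hωη : ∀ s ∈ Set.Icc 0 (t : ℝ), ω.1 s = η.1 s) : X t = X' t := by
  have ht : (t : ℝ) ∈ Set.Icc 0 (t : ℝ) := ⟨t.coe_nonneg, le_rfl⟩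
  have := hX.isShiftedSolution.eqOn hX'.isShiftedSolution hωη ht
  simp only [Real.toNNReal_coe, hωη t ht] at this
  linarith

/-! ### The explicit solution flow -/

/-- The solution at time `t` of `y' = y - y³`, `y 0 = x`. -/
noncomputable def driftFlow (t x : ℝ) : ℝ :=
  x * Real.exp t / √(1 + x ^ 2 * (Real.exp (2 * t) - 1))

lemma driftFlow_zero (x : ℝ) : driftFlow 0 x = x := by simp [driftFlow]

lemma one_le_one_add_sq_mul_exp_sub_one {t : ℝ} (ht : 0 ≤ t) (x : ℝ) :
    1 ≤ 1 + x ^ 2 * (Real.exp (2 * t) - 1) := by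
  have : 0 ≤ Real.exp (2 * t) - 1 := by
    have := Real.one_le_exp (by linarith : 0 ≤ 2 * t)
    linarith
  have := mul_nonneg (sq_nonneg x) this
  linarith

lemma hasDerivAt_driftFlow {t : ℝ} (ht : 0 ≤ t) (x : ℝ) :
    HasDerivAt (fun s => driftFlow s x) (drift (driftFlow t x)) t := by
  have hD := one_le_one_add_sq_mul_exp_sub_one ht x
  set D := 1 + x ^ 2 * (Real.exp (2 * t) - 1) with hDdef
  have h1 : HasDerivAt (fun s => 1 + x ^ 2 * (Real.exp (2 * s) - 1))
      (x ^ 2 * (Real.exp (2 * t) * 2)) t := by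
    have : HasDerivAt (fun s : ℝ => Real.exp (2 * s)) (Real.exp (2 * t) * 2) t := by
      have := (hasDerivAt_id t).const_mul 2
      simpa using this.exp
    simpa using ((this.sub_const 1).const_mul (x ^ 2)).const_add 1
  have h2 := h1.sqrt (by rw [← hDdef]; linarith)
  have h3 : HasDerivAt (fun s => x * Real.exp s) (x * Real.exp t) t :=
    (Real.hasDerivAt_exp t).const_mul x
  have hpos : 0 < √D := Real.sqrt_pos.2 (by linarith)
  refine (h3.div h2 hpos.ne').congr_deriv ?_
  have hE : Real.exp (2 * t) = Real.exp t ^ 2 := by rw [two_mul, Real.exp_add, sq]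
  simp only [drift, driftFlow, ← hDdef]
  have hs : √D ^ 2 = D := Real.sq_sqrt (by linarith)
  rw [hE]
  field_simp

lemma continuous_driftFlow {t : ℝ} (ht : 0 ≤ t) : Continuous (driftFlow t) := by
  refine Continuous.div (by fun_prop) (by fun_prop) fun x => ?_
  exact (Real.sqrt_pos.2 (by linarith [one_le_one_add_sq_mul_exp_sub_one ht x])).ne'

lemma measurable_driftFlow : Measurable (fun p : ℝ × ℝ => driftFlow p.1 p.2) := by
  unfold driftFlow; fun_prop

/-- For `0 ≤ x ≤ y`, squaring the cross-multiplied inequality reduces it to `x ^ 2 ≤ y ^ 2`; oddness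
and signs settle the rest. -/
lemma monotone_driftFlow {t : ℝ} (ht : 0 ≤ t) : Monotone (driftFlow t) := by
  have ha : 0 ≤ Real.exp (2 * t) - 1 := by
    have := Real.one_le_exp (by linarith : 0 ≤ 2 * t)
    linarith
  have hpos : ∀ x, 0 < √(1 + x ^ 2 * (Real.exp (2 * t) - 1)) := fun x =>
    Real.sqrt_pos.2 (by linarith [one_le_one_add_sq_mul_exp_sub_one ht x])
  have hnonneg : ∀ x y, 0 ≤ x → x ≤ y → driftFlow t x ≤ driftFlow t y := by
    intro x y hx hxy
    unfold driftFlow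
    rw [div_le_div_iff₀ (hpos x) (hpos y)]
    have hxy2 : x ^ 2 ≤ y ^ 2 := by nlinarith
    have h : x * √(1 + y ^ 2 * (Real.exp (2 * t) - 1)) ≤
        y * √(1 + x ^ 2 * (Real.exp (2 * t) - 1)) := by
      rw [← abs_of_nonneg hx, ← abs_of_nonneg (hx.trans hxy), ← Real.sqrt_sq_eq_abs,
        ← Real.sqrt_sq_eq_abs, ← Real.sqrt_mul (sq_nonneg _), ← Real.sqrt_mul (sq_nonneg _)]
      apply Real.sqrt_le_sqrt
      simp only [Real.sqrt_sq_eq_abs, sq_abs]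
      nlinarith
    nlinarith [Real.exp_pos t]
  have hodd : ∀ x, driftFlow t (-x) = -driftFlow t x := by
    intro x; simp [driftFlow, neg_div]
  have hsign : ∀ x, 0 ≤ x → 0 ≤ driftFlow t x := fun x hx => by
    unfold driftFlow; positivity
  intro x y hxy
  rcases le_total 0 x with hx | hx
  · exact hnonneg x y hx hxy
  rcases le_total 0 y with hy | hy
  · have := hsign (-x) (by linarith)
    rw [hodd] at this
    linarith [hsign y hy]
  · have := hnonneg (-y) (-x) (by linarith) (by linarith)
    rw [hodd, hodd] at this
    linarith

/-! ### Jump times -/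

namespace CountingPath

/-- The time of the `k`-th jump on the positive half-line. -/
noncomputable def jumpTime (ω : CountingPath) (k : ℕ) : ℝ := sInf {s | 0 ≤ s ∧ (k : ℤ) ≤ ω.1 s}

lemma bddBelow_jumpTime (ω : CountingPath) (k : ℕ) : BddBelow {s : ℝ | 0 ≤ s ∧ (k : ℤ) ≤ ω.1 s} :=
  ⟨0, fun _ h => h.1⟩

lemma jumpTime_nonneg (ω : CountingPath) (k : ℕ) : 0 ≤ ω.jumpTime k :=
  Real.sInf_nonneg fun _ h => h.1

lemma jumpTime_le (ω : CountingPath) {k : ℕ} {t : ℝ} (ht : 0 ≤ t) (hk : (k : ℤ) ≤ ω.1 t) :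
    ω.jumpTime k ≤ t :=
  csInf_le (ω.bddBelow_jumpTime k) ⟨ht, hk⟩

/-- Level `k` must be reached: for a level never reached, `sInf ∅ = 0` would break the order. -/
lemma jumpTime_mono (ω : CountingPath) {j k : ℕ} (hjk : j ≤ k) {t : ℝ} (ht : 0 ≤ t)
    (hk : (k : ℤ) ≤ ω.1 t) : ω.jumpTime j ≤ ω.jumpTime k :=
  csInf_le_csInf (ω.bddBelow_jumpTime j) ⟨t, ht, hk⟩
    fun _ h => ⟨h.1, (Int.ofNat_le.2 hjk).trans h.2⟩

lemma jumpTime_zero (ω : CountingPath) : ω.jumpTime 0 = 0 :=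
  le_antisymm (ω.jumpTime_le le_rfl (by simpa using ω.nonneg le_rfl)) (ω.jumpTime_nonneg 0)

lemma jumpTime_eq (ω : CountingPath) {k : ℕ} {s t : ℝ} (hs : 0 ≤ s) (hst : s < t)
    (hω : ∀ u, s ≤ u → u < t → ω.1 u = ω.1 s) (hsk : ω.1 s < k) (hk : (k : ℤ) ≤ ω.1 t) :
    ω.jumpTime k = t := by
  have ht : 0 ≤ t := hs.trans hst.le
  refine le_antisymm (ω.jumpTime_le ht hk) (le_csInf ⟨t, ht, hk⟩ fun u hu => ?_)
  by_contra! h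
  have h1 : ω.1 u ≤ ω.1 (max s u) := ω.2.1 (le_max_right _ _)
  rw [hω _ (le_max_left _ _) (max_lt hst h)] at h1
  exact absurd (hu.2.trans h1) (not_le.2 hsk)

lemma measurable_jumpTime (k : ℕ) : Measurable (fun ω : CountingPath => ω.jumpTime k) := by
  refine measurable_of_Iic fun c => ?_
  rcases lt_or_ge c 0 with hc | hc
  · convert MeasurableSet.empty
    ext ω
    simp only [Set.mem_preimage, Set.mem_Iic, Set.mem_empty_iff_false, iff_false, not_le]
    exact hc.trans_le (ω.jumpTime_nonneg k)
  -- The second set collects the paths that never reach level `k`, whose jump time has the default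
  -- value `0 ≤ c`.
  have : (fun ω : CountingPath => ω.jumpTime k) ⁻¹' Set.Iic c =
      {ω | (k : ℤ) ≤ ω.1 c} ∪ ⋂ n : ℕ, {ω | ω.1 n < (k : ℤ)} := by
    ext ω
    simp only [Set.mem_preimage, Set.mem_Iic, Set.mem_union, Set.mem_ofPred_eq, Set.mem_iInter]
    constructor
    · intro h
      by_cases hne : {s : ℝ | 0 ≤ s ∧ (k : ℤ) ≤ ω.1 s}.Nonempty
      · left
        obtain ⟨u, hu, hω⟩ := ω.exists_eq_right c
        obtain ⟨s, hs, hsu⟩ := exists_lt_of_csInf_lt hne (lt_of_le_of_lt h hu)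
        have h1 : ω.1 s ≤ ω.1 (max c s) := ω.2.1 (le_max_right _ _)
        rw [hω _ (le_max_left _ _) (max_lt hu hsu)] at h1
        exact hs.2.trans h1
      · right
        intro n
        by_contra! hn
        exact hne ⟨n, n.cast_nonneg, hn⟩
    · rintro (h | h)
      · exact ω.jumpTime_le hc h
      · have : {s : ℝ | 0 ≤ s ∧ (k : ℤ) ≤ ω.1 s} = ∅ := by
          ext s
          simp only [Set.mem_ofPred_eq, Set.mem_empty_iff_false, iff_false, not_and, not_le]
          intro _
          obtain ⟨n, hn⟩ := exists_nat_ge s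
          exact (ω.2.1 hn).trans_lt (h n)
        rw [jumpTime, this, Real.sInf_empty]
        exact hc
  rw [this]
  exact ((measurable_eval c) measurableSet_Ici).union
    (MeasurableSet.iInter fun n => (measurable_eval n) measurableSet_Iio)

end CountingPath

/-- The solution just after the `k`-th jump. -/
noncomputable def stateAfterJump (σ : ℝ) (ω : CountingPath) (x : ℝ) : ℕ → ℝ
  | 0 => x
  | k + 1 => driftFlow (ω.jumpTime (k + 1) - ω.jumpTime k) (stateAfterJump σ ω x k) + σ

/-- The solution flow, obtained by following `driftFlow` between the jumps. -/
noncomputable def jumpFlow (σ : ℝ) (t : ℝ) (ω : CountingPath) (x : ℝ) : ℝ :=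
  driftFlow (t - ω.jumpTime (ω.1 t).toNat) (stateAfterJump σ ω x (ω.1 t).toNat)

/-! ### Regularity of the explicit flow -/

lemma continuous_stateAfterJump (σ : ℝ) (ω : CountingPath) {t : ℝ} (ht : 0 ≤ t) (k : ℕ)
    (hk : (k : ℤ) ≤ ω.1 t) : Continuous fun x => stateAfterJump σ ω x k := by
  induction k with
  | zero => exact continuous_id
  | succ k ih =>
    exact ((continuous_driftFlow (sub_nonneg.2 (ω.jumpTime_mono k.le_succ ht hk))).comp
      (ih (by push_cast at hk; linarith))).add continuous_const

lemma monotone_stateAfterJump (σ : ℝ) (ω : CountingPath) {t : ℝ} (ht : 0 ≤ t) (k : ℕ)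
    (hk : (k : ℤ) ≤ ω.1 t) : Monotone fun x => stateAfterJump σ ω x k := by
  induction k with
  | zero => exact monotone_id
  | succ k ih =>
    exact ((monotone_driftFlow (sub_nonneg.2 (ω.jumpTime_mono k.le_succ ht hk))).comp
      (ih (by push_cast at hk; linarith))).add_const σ

lemma measurable_stateAfterJump (σ : ℝ) (k : ℕ) :
    Measurable fun p : CountingPath × ℝ => stateAfterJump σ p.1 p.2 k := by
  induction k with
  | zero => exact measurable_snd
  | succ k ih =>
    exact (measurable_driftFlow.comp
      ((((CountingPath.measurable_jumpTime (k + 1)).sub (CountingPath.measurable_jumpTime k)).comp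
        measurable_fst).prodMk ih)).add measurable_const

lemma CountingPath.toNat_le (ω : CountingPath) {t : ℝ} (ht : 0 ≤ t) :
    ((ω.1 t).toNat : ℤ) ≤ ω.1 t := (Int.toNat_of_nonneg (ω.nonneg ht)).le

lemma continuous_jumpFlow (σ : ℝ) {t : ℝ} (ht : 0 ≤ t) (ω : CountingPath) :
    Continuous (jumpFlow σ t ω) :=
  (continuous_driftFlow (sub_nonneg.2 (ω.jumpTime_le ht (ω.toNat_le ht)))).comp
    (continuous_stateAfterJump σ ω ht _ (ω.toNat_le ht))

lemma monotone_jumpFlow (σ : ℝ) {t : ℝ} (ht : 0 ≤ t) (ω : CountingPath) :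
    Monotone (jumpFlow σ t ω) :=
  (monotone_driftFlow (sub_nonneg.2 (ω.jumpTime_le ht (ω.toNat_le ht)))).comp
    (monotone_stateAfterJump σ ω ht _ (ω.toNat_le ht))

lemma measurable_jumpFlow (σ : ℝ) :
    Measurable fun p : ℝ × CountingPath × ℝ => jumpFlow σ p.1 p.2.1 p.2.2 := by
  have hn : Measurable fun p : ℝ × CountingPath × ℝ => (p.2.1.1 p.1).toNat :=
    (measurable_from_top (f := Int.toNat)).comp (CountingPath.measurable_uncurry_eval.comp
      (measurable_fst.prodMk (measurable_fst.comp measurable_snd)))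
  -- The jump count is first a free variable in the countable type `ℕ`; the actual count is
  -- substituted afterwards.
  have hF : Measurable fun q : (ℝ × CountingPath × ℝ) × ℕ =>
      driftFlow (q.1.1 - q.1.2.1.jumpTime q.2) (stateAfterJump σ q.1.2.1 q.1.2.2 q.2) := by
    refine measurable_from_prod_countable_left fun k => ?_
    exact measurable_driftFlow.comp
      ((measurable_fst.sub ((CountingPath.measurable_jumpTime k).comp
        (measurable_fst.comp measurable_snd))).prodMk
        ((measurable_stateAfterJump σ k).comp measurable_snd))
  exact hF.comp (measurable_id.prodMk hn)

/-! ### The explicit flow solves the equation -/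

/-- A path may jump by more than one. All levels passed at `t` then share the jump time `t`, and
each adds `σ` with no drift in between. -/
lemma driftFlow_stateAfterJump (σ : ℝ) (ω : CountingPath) (x : ℝ) {s t : ℝ} {m : ℕ} (hs : 0 ≤ s)
    (hst : s < t) (hω : ∀ u, s ≤ u → u < t → ω.1 u = ω.1 s) (hm : ω.1 s = m) (k : ℕ) (hmk : m ≤ k)
    (hk : (k : ℤ) ≤ ω.1 t) :
    driftFlow (t - ω.jumpTime k) (stateAfterJump σ ω x k) =
      driftFlow (t - ω.jumpTime m) (stateAfterJump σ ω x m) + σ * (k - m) := by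
  induction k, hmk using Nat.le_induction with
  | base => simp
  | succ k hmk ih =>
    have hk' : (k : ℤ) ≤ ω.1 t := by push_cast at hk; linarith
    have hT : ω.jumpTime (k + 1) = t := ω.jumpTime_eq hs hst hω (by rw [hm]; push_cast; omega) hk
    rw [hT, sub_self, driftFlow_zero, stateAfterJump, hT, ih hk']
    push_cast; ring

lemma isShiftedSolution_jumpFlow (σ : ℝ) (ω : CountingPath) (x : ℝ) :
    IsShiftedSolution σ ω x (fun t => jumpFlow σ t ω x - σ * ω.1 t) := by
  have hderiv : ∀ t, 0 ≤ t → HasDerivWithinAt (fun t => jumpFlow σ t ω x - σ * ω.1 t)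
      (drift (jumpFlow σ t ω x - σ * ω.1 t + σ * ω.1 t)) (Set.Ici t) t := by
    intro t ht
    obtain ⟨u, hu, hω⟩ := ω.exists_eq_right t
    have h1 := hasDerivAt_driftFlow (sub_nonneg.2 (ω.jumpTime_le ht (ω.toNat_le ht)))
      (stateAfterJump σ ω x (ω.1 t).toNat)
    have h2 := ((h1.comp_sub_const t (ω.jumpTime (ω.1 t).toNat)).sub_const
      (σ * ω.1 t)).hasDerivWithinAt (s := Set.Ici t)
    rw [sub_add_cancel]
    refine h2.congr_of_eventuallyEq ?_ rfl
    filter_upwards [Ico_mem_nhdsGE hu] with s hs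
    simp only [jumpFlow, hω s hs.1 hs.2]
  refine ⟨?_, fun T t ht => ?_, hderiv⟩
  · simp [jumpFlow, ω.2.2.2, ω.jumpTime_zero, driftFlow_zero, stateAfterJump]
  have hr := (hderiv t ht.1).continuousWithinAt
  rcases ht.1.eq_or_lt with h0 | h0
  · rw [← h0] at hr ⊢
    exact hr.mono Set.Icc_subset_Ici_self
  refine ContinuousAt.continuousWithinAt
    (continuousAt_iff_continuous_left'_right'.2 ⟨?_, hr.mono Set.Ioi_subset_Ici_self⟩)
  -- Left continuity: the value at `t` is compared with the drift flow continued from the stretch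
  -- before `t`, where the path is constant at level `m`.
  obtain ⟨s', hs't, hω'⟩ := ω.exists_eq_left t
  obtain ⟨s, hs, hst, hω⟩ : ∃ s, 0 ≤ s ∧ s < t ∧ ∀ u, s ≤ u → u < t → ω.1 u = ω.1 s := by
    refine ⟨max s' 0, le_max_right _ _, max_lt hs't h0, fun u h1 h2 => ?_⟩
    rw [hω' u ((le_max_left _ _).trans h1) h2, hω' _ (le_max_left _ _) (max_lt hs't h0)]
  set m := (ω.1 s).toNat with hmdef
  have hm : ω.1 s = m := (Int.toNat_of_nonneg (ω.nonneg hs)).symm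
  have hn : ω.1 t = ((ω.1 t).toNat : ℤ) := (Int.toNat_of_nonneg (ω.nonneg h0.le)).symm
  have hmn : m ≤ (ω.1 t).toNat := by
    have := ω.2.1 hst.le
    omega
  have hval : jumpFlow σ t ω x - σ * ω.1 t =
      driftFlow (t - ω.jumpTime m) (stateAfterJump σ ω x m) - σ * m := by
    have := driftFlow_stateAfterJump σ ω x hs hst hω hm _ hmn hn.symm.le
    have hn' : (ω.1 t : ℝ) = ((ω.1 t).toNat : ℝ) := by
      rw [← Int.cast_natCast (R := ℝ), ← hn]
    rw [jumpFlow, this, hn']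
    ring
  have hTm : ω.jumpTime m ≤ t := (ω.jumpTime_le hs hm.symm.le).trans hst.le
  have h1 := (((hasDerivAt_driftFlow (sub_nonneg.2 hTm)
    (stateAfterJump σ ω x m)).comp_sub_const t (ω.jumpTime m)).sub_const
      (σ * m)).continuousAt.continuousWithinAt (s := Set.Iio t)
  refine h1.congr_of_eventuallyEq ?_ hval
  filter_upwards [Ioo_mem_nhdsLT hst] with u hu
  have hωu : ω.1 u = m := by rw [hω u hu.1.le hu.2, hm]
  simp [jumpFlow, hωu]

lemma isSolutionFlow_jumpFlow (σ : ℝ) :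
    IsSolutionFlow σ (fun (t : ℝ≥0) ω x => jumpFlow σ t ω x) := fun ω x =>
  (isShiftedSolution_jumpFlow σ ω x).isSolution fun t => by ring

lemma IsSolutionFlow.eq {σ : ℝ} {φ ψ : ℝ≥0 → CountingPath → ℝ → ℝ} (hφ : IsSolutionFlow σ φ)
    (hψ : IsSolutionFlow σ ψ) : φ = ψ := by
  funext t ω x
  exact (hφ ω x).eq_of_eqOn (hψ ω x) fun _ _ => rfl

lemma existsUnique_isSolutionFlow (σ : ℝ) :
    ∃! φ : ℝ≥0 → CountingPath → ℝ → ℝ, IsSolutionFlow σ φ :=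
  ⟨_, isSolutionFlow_jumpFlow σ, fun _ h => h.eq (isSolutionFlow_jumpFlow σ)⟩

/-! ### Cocycle property, locality and a priori bounds -/

lemma IsShiftedSolution.shift {σ : ℝ} {ω : CountingPath} {x : ℝ} {Y : ℝ → ℝ}
    (h : IsShiftedSolution σ ω x Y) {s : ℝ} (hs : 0 ≤ s) :
    IsShiftedSolution σ (CountingPath.shift s ω) (Y s + σ * ω.1 s)
      (fun u => Y (u + s) + σ * ω.1 s) := by
  refine ⟨by simp, fun T => ?_, fun t ht => ?_⟩
  · refine ContinuousOn.add ?_ continuousOn_const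
    refine (h.continuousOn (T + s)).comp (by fun_prop) fun u hu => ⟨?_, ?_⟩
    · linarith [hu.1]
    · linarith [hu.2]
  · have h1 := h.hasDerivWithinAt (t + s) (by linarith)
    have h2 : HasDerivWithinAt (fun u => Y (u + s)) (drift (Y (t + s) + σ * ω.1 (t + s)))
        (Set.Ici t) t := by
      have h3 : HasDerivWithinAt (fun u : ℝ => u + s) 1 (Set.Ici t) t :=
        ((hasDerivAt_id t).add_const s).hasDerivWithinAt
      simpa [Function.comp_def] using
        h1.scomp (h := fun u : ℝ => u + s) t h3 (fun u hu => by simpa using hu)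
    refine (h2.add_const (σ * ω.1 s)).congr_deriv ?_
    rw [CountingPath.shift_apply]
    congr 1
    push_cast; ring

lemma jumpFlow_add (σ : ℝ) {s t : ℝ} (hs : 0 ≤ s) (ht : 0 ≤ t) (ω : CountingPath) (x : ℝ) :
    jumpFlow σ (t + s) ω x = jumpFlow σ t (CountingPath.shift s ω) (jumpFlow σ s ω x) := by
  have h1 := (isShiftedSolution_jumpFlow σ ω x).shift hs
  rw [sub_add_cancel] at h1
  have h2 := h1.eqOn (isShiftedSolution_jumpFlow σ (CountingPath.shift s ω) (jumpFlow σ s ω x))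
    (fun _ _ => rfl) (Set.right_mem_Icc.2 ht)
  simp only [CountingPath.shift_apply] at h2
  push_cast at h2
  linarith

lemma jumpFlow_congr (σ : ℝ) {t : ℝ} (ht : 0 ≤ t) {ω η : CountingPath}
    (h : ∀ s ∈ Set.Icc 0 t, ω.1 s = η.1 s) (x : ℝ) : jumpFlow σ t ω x = jumpFlow σ t η x := by
  have h1 := (isShiftedSolution_jumpFlow σ ω x).eqOn (isShiftedSolution_jumpFlow σ η x) h
    (Set.right_mem_Icc.2 ht)
  simp only [h t (Set.right_mem_Icc.2 ht)] at h1
  linarith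

lemma jumpFlow_zero (σ : ℝ) (ω : CountingPath) (x : ℝ) : jumpFlow σ 0 ω x = x := by
  have := (isShiftedSolution_jumpFlow σ ω x).zero
  simpa [ω.2.2.2] using this

lemma isRDS_jumpFlow {rate : ℝ≥0} {P : Measure CountingPath} (hP : IsPoissonLaw rate P) (σ : ℝ) :
    IsRDS P CountingPath.shift (fun (t : ℝ≥0) ω x => jumpFlow σ t ω x) where
  base := hP.isErgodicMDS
  measurable := (measurable_jumpFlow σ).comp
    ((measurable_subtype_coe.comp measurable_fst).prodMk measurable_snd)
  zero := jumpFlow_zero σ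
  cocycle s t ω x := by
    simpa using jumpFlow_add σ s.coe_nonneg t.coe_nonneg ω x
  continuous t ω := continuous_jumpFlow σ t.coe_nonneg ω

/-! ### Coming down from infinity -/

lemma drift_one_add_lt {v : ℝ} (hv : 0 < v) : drift (1 + v) < -v ^ 2 := by
  unfold drift
  nlinarith [pow_pos hv 2, pow_pos hv 3]

/-- The barrier `1 + t⁻¹ + c` is infinite at `0+`, so it lies above `f` initially whatever `f 0` is,
and its slope `-(t⁻¹) ^ 2` exceeds `drift (1 + t⁻¹)`. -/
lemma le_one_add_inv_of_hasDerivWithinAt {f f' : ℝ → ℝ} {T c : ℝ} (hT : 0 < T)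
    (hf : ContinuousOn f (Set.Icc 0 T))
    (hf' : ∀ t, 0 ≤ t → t < T → HasDerivWithinAt f (f' t) (Set.Ici t) t)
    (hbound : ∀ t, 0 < t → t < T → f t = 1 + t⁻¹ + c → f' t ≤ drift (1 + t⁻¹)) :
    f T ≤ 1 + T⁻¹ + c := by
  obtain ⟨C, hC⟩ := isCompact_Icc.exists_bound_of_continuousOn hf
  -- The comparison starts at `a`, so small that `a⁻¹` dominates the bound on `f` and `|c|`.
  set a := min T (|C| + |c| + 1)⁻¹ with ha
  have hpos : 0 < (|C| + |c| + 1)⁻¹ := by positivity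
  have ha0 : 0 < a := lt_min hT hpos
  have haT : a ≤ T := min_le_left _ _
  have hainv : |C| + |c| + 1 ≤ a⁻¹ := by
    rw [← inv_inv (|C| + |c| + 1)]
    exact inv_anti₀ ha0 (min_le_right _ _)
  refine image_le_of_deriv_right_lt_deriv_boundary' (a := a) (b := T)
    (B := fun t => 1 + t⁻¹ + c) (B' := fun t => -(t ^ 2)⁻¹)
    (hf.mono (Set.Icc_subset_Icc_left ha0.le))
    (fun t ht => hf' t (ha0.le.trans ht.1) ht.2) ?_ ?_ ?_ ?_ ⟨haT, le_rfl⟩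
  · have h1 := hC a ⟨ha0.le, haT⟩
    rw [Real.norm_eq_abs] at h1
    linarith [le_abs_self (f a), le_abs_self C, neg_abs_le c]
  · refine ContinuousOn.add (ContinuousOn.add continuousOn_const ?_) continuousOn_const
    exact continuousOn_inv₀.mono fun t ht => (ha0.trans_le ht.1).ne'
  · intro t ht
    have := (((hasDerivAt_inv (ha0.trans_le ht.1).ne').const_add 1).add_const c)
    exact this.hasDerivWithinAt
  · intro t ht heq
    have ht0 : 0 < t := ha0.trans_le ht.1
    refine (hbound t ht0 ht.2 heq).trans_lt ?_
    have := drift_one_add_lt (inv_pos.2 ht0)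
    rwa [inv_pow] at this

lemma jumpFlow_le {σ : ℝ} (hσ : 0 ≤ σ) {t : ℝ} (ht : 0 < t) (ω : CountingPath) (x : ℝ) :
    jumpFlow σ t ω x ≤ 1 + t⁻¹ + σ * ω.1 t := by
  have hY := isShiftedSolution_jumpFlow σ ω x
  have := le_one_add_inv_of_hasDerivWithinAt (c := 0) ht (hY.continuousOn t)
    (fun s hs _ => hY.hasDerivWithinAt s hs) (fun s hs _ heq => ?_)
  · linarith
  · have hω : (0 : ℝ) ≤ ω.1 s := by exact_mod_cast ω.nonneg hs.le
    have h1 := mul_nonneg hσ hω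
    have h2 := inv_pos.2 hs
    exact drift_anti (by linarith) (by linarith)

/-- The barrier argument is applied to `-(X - σ N)`; the choice `c = σ * ω.1 t` absorbs the noise,
which is largest at the final time. -/
lemma le_jumpFlow {σ : ℝ} (hσ : 0 ≤ σ) {t : ℝ} (ht : 0 < t) (ω : CountingPath) (x : ℝ) :
    -(1 + t⁻¹) ≤ jumpFlow σ t ω x := by
  have hY := isShiftedSolution_jumpFlow σ ω x
  have := le_one_add_inv_of_hasDerivWithinAt (c := σ * ω.1 t) ht (hY.continuousOn t).neg
    (fun s hs _ => (hY.hasDerivWithinAt s hs).neg) (fun s hs hst heq => ?_)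
  · simp only [Pi.neg_apply] at this
    linarith
  · simp only [Pi.neg_apply] at heq
    have hω : (ω.1 s : ℝ) ≤ ω.1 t := by exact_mod_cast ω.2.1 hst.le
    have h1 := mul_le_mul_of_nonneg_left hω hσ
    have h2 := inv_pos.2 hs
    rw [← drift_neg]
    exact drift_anti (by linarith) (by linarith)

/-- At time `a ≥ 1 / 2` every solution is at least `-3`. Then `k` jumps of total height at least `6`
occur in a time too short for the drift to cost `1`. The value `2` is the upper bound `1 + 1⁻¹` for
a unit interval without jumps. -/
lemma exists_forall_two_lt_jumpFlow {σ : ℝ} (hσ : 0 < σ) :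
    ∃ (k : ℕ) (a : ℝ), 0 ≤ a ∧ a < 1 ∧
      ∀ ω : CountingPath, ω.1 a = 0 → ω.1 1 = k → ∀ x, 2 < jumpFlow σ 1 ω x := by
  obtain ⟨k, hk⟩ := exists_nat_ge (6 / σ)
  rw [div_le_iff₀ hσ] at hk
  -- From time `1 / 2` on, the a priori bounds confine solutions with at most `k` jumps to this
  -- interval.
  obtain ⟨M, hM⟩ := isCompact_Icc.exists_bound_of_continuousOn
    (continuous_drift.continuousOn (s := Set.Icc (-3) (3 + σ * k)))
  set δ := min (1 / 2) (|M| + 1)⁻¹ with hδ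
  have hMpos : 0 < |M| + 1 := by positivity
  have hδ0 : 0 < δ := lt_min (by norm_num) (by positivity)
  have hδ2 : δ ≤ 1 / 2 := min_le_left _ _
  have hMδ : |M| * δ < 1 := by
    have : δ ≤ (|M| + 1)⁻¹ := min_le_right _ _
    calc |M| * δ < (|M| + 1) * δ := by nlinarith
      _ ≤ (|M| + 1) * (|M| + 1)⁻¹ := by gcongr
      _ = 1 := mul_inv_cancel₀ hMpos.ne'
  refine ⟨k, 1 - δ, by linarith, by linarith, fun ω hω0 hω1 x => ?_⟩
  have hY := isShiftedSolution_jumpFlow σ ω x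
  have hinv : ∀ t : ℝ, 1 / 2 ≤ t → t⁻¹ ≤ 2 := fun t ht => by
    have := inv_anti₀ (by norm_num : (0 : ℝ) < 1 / 2) ht
    norm_num at this ⊢
    exact this
  have hmv := image_le_of_deriv_right_le_deriv_boundary (a := 1 - δ) (b := 1)
    (f := fun t => -(jumpFlow σ t ω x - σ * ω.1 t))
    (B := fun t => -(jumpFlow σ (1 - δ) ω x - σ * ω.1 (1 - δ)) + |M| * (t - (1 - δ)))
    (B' := fun _ => |M|)
    (((hY.continuousOn 1).mono (Set.Icc_subset_Icc_left (by linarith))).neg)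
    (fun t ht => (hY.hasDerivWithinAt t (by linarith [ht.1])).neg) (by simp) (by fun_prop)
    (fun t _ => by
      have := (((hasDerivAt_id t).sub_const (1 - δ)).const_mul |M|).const_add
        (-(jumpFlow σ (1 - δ) ω x - σ * ω.1 (1 - δ)))
      simpa using this.hasDerivWithinAt)
    (fun t ht => by
      have ht2 : 1 / 2 ≤ t := by linarith [ht.1]
      have h1 := le_jumpFlow hσ.le (by linarith : 0 < t) ω x
      have h2 := jumpFlow_le hσ.le (by linarith : 0 < t) ω x
      have h3 := hinv t ht2
      have h4 : (ω.1 t : ℝ) ≤ k := by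
        have := ω.2.1 ht.2.le
        rw [hω1] at this
        exact_mod_cast this
      have h5 := mul_le_mul_of_nonneg_left h4 hσ.le
      have := hM (jumpFlow σ t ω x) ⟨by linarith, by linarith⟩
      rw [sub_add_cancel]
      rw [Real.norm_eq_abs] at this
      linarith [neg_abs_le (drift (jumpFlow σ t ω x)), le_abs_self M])
    (⟨by linarith, le_rfl⟩ : (1 : ℝ) ∈ Set.Icc (1 - δ) 1)
  have h1 := le_jumpFlow hσ.le (by linarith : 0 < 1 - δ) ω x
  have h2 := hinv (1 - δ) (by linarith)
  simp only [hω0, hω1, Int.cast_zero, mul_zero, sub_zero, Int.cast_natCast] at hmv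
  nlinarith

/-! ### Pullback envelopes of the flow -/

/-- The supremum over all starting points of the flow started at time `-t` and observed at `0`. -/
noncomputable def upperPullback (σ t : ℝ) (ω : CountingPath) : ℝ :=
  ⨆ k : ℕ, jumpFlow σ t (CountingPath.shift (-t) ω) k

/-- The infimum over all starting points of the flow started at time `-t` and observed at `0`. -/
noncomputable def lowerPullback (σ t : ℝ) (ω : CountingPath) : ℝ :=
  ⨅ k : ℕ, jumpFlow σ t (CountingPath.shift (-t) ω) (-k)

lemma CountingPath.shift_shift (s t : ℝ) (ω : CountingPath) :
    shift s (shift t ω) = shift (s + t) ω := (shift_add s t ω).symm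

lemma jumpFlow_pullback_add (σ : ℝ) {s t : ℝ} (hs : 0 ≤ s) (ht : 0 ≤ t) (ω : CountingPath)
    (x : ℝ) : jumpFlow σ (t + s) (CountingPath.shift (-t) ω) x =
      jumpFlow σ s ω (jumpFlow σ t (CountingPath.shift (-t) ω) x) := by
  rw [add_comm, jumpFlow_add σ ht hs, CountingPath.shift_shift, add_neg_cancel,
    CountingPath.shift_zero]

lemma jumpFlow_pullback_of_le (σ : ℝ) {s t : ℝ} (hs : 0 ≤ s) (hst : s ≤ t) (ω : CountingPath)
    (x : ℝ) : jumpFlow σ t (CountingPath.shift (-t) ω) x =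
      jumpFlow σ s (CountingPath.shift (-s) ω)
        (jumpFlow σ (t - s) (CountingPath.shift (-t) ω) x) := by
  have := jumpFlow_add σ (sub_nonneg.2 hst) hs (CountingPath.shift (-t) ω) x
  rw [CountingPath.shift_shift] at this
  rw [show s + (t - s) = t by ring, show t - s + -t = -s by ring] at this
  exact this

section envelopes

variable {σ t : ℝ}

lemma bddAbove_pullback (hσ : 0 ≤ σ) (ht : 0 < t) (ω : CountingPath) :
    BddAbove (Set.range fun k : ℕ => jumpFlow σ t (CountingPath.shift (-t) ω) k) :=
  ⟨_, by rintro _ ⟨k, rfl⟩; exact jumpFlow_le hσ ht _ _⟩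

lemma bddBelow_pullback (hσ : 0 ≤ σ) (ht : 0 < t) (ω : CountingPath) :
    BddBelow (Set.range fun k : ℕ => jumpFlow σ t (CountingPath.shift (-t) ω) (-k)) :=
  ⟨_, by rintro _ ⟨k, rfl⟩; exact le_jumpFlow hσ ht _ _⟩

/-- By monotonicity the integer starting points are cofinal, so a countable, hence measurable,
supremum covers all of them. -/
lemma le_upperPullback (hσ : 0 ≤ σ) (ht : 0 < t) (ω : CountingPath) (x : ℝ) :
    jumpFlow σ t (CountingPath.shift (-t) ω) x ≤ upperPullback σ t ω := by
  obtain ⟨k, hk⟩ := exists_nat_ge x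
  exact (monotone_jumpFlow σ ht.le _ hk).trans (le_ciSup (bddAbove_pullback hσ ht ω) k)

lemma lowerPullback_le (hσ : 0 ≤ σ) (ht : 0 < t) (ω : CountingPath) (x : ℝ) :
    lowerPullback σ t ω ≤ jumpFlow σ t (CountingPath.shift (-t) ω) x := by
  obtain ⟨k, hk⟩ := exists_nat_ge (-x)
  exact (ciInf_le (bddBelow_pullback hσ ht ω) k).trans
    (monotone_jumpFlow σ ht.le _ (by linarith))

lemma lowerPullback_le_upperPullback (hσ : 0 ≤ σ) (ht : 0 < t) (ω : CountingPath) :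
    lowerPullback σ t ω ≤ upperPullback σ t ω :=
  (lowerPullback_le hσ ht ω 0).trans (le_upperPullback hσ ht ω 0)

/-- Starting earlier only restricts the states available at time `-t`. -/
lemma upperPullback_anti (hσ : 0 ≤ σ) (ht : 0 < t) (ω : CountingPath) {u : ℝ} (htu : t ≤ u) :
    upperPullback σ u ω ≤ upperPullback σ t ω :=
  ciSup_le fun k => by
    rw [jumpFlow_pullback_of_le σ ht.le htu]
    exact le_upperPullback hσ ht ω _

lemma lowerPullback_mono (hσ : 0 ≤ σ) (ht : 0 < t) (ω : CountingPath) {u : ℝ} (htu : t ≤ u) :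
    lowerPullback σ t ω ≤ lowerPullback σ u ω :=
  le_ciInf fun k => by
    rw [jumpFlow_pullback_of_le σ ht.le htu]
    exact lowerPullback_le hσ ht ω _

lemma upperPullback_shift (hσ : 0 ≤ σ) (ht : 0 < t) (ω : CountingPath) {s : ℝ} (hs : 0 ≤ s) :
    upperPullback σ (t + s) (CountingPath.shift s ω) = jumpFlow σ s ω (upperPullback σ t ω) := by
  rw [upperPullback, upperPullback, Monotone.map_ciSup_of_continuousAt
    (continuous_jumpFlow σ hs ω).continuousAt (monotone_jumpFlow σ hs ω)
    (bddAbove_pullback hσ ht ω)]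
  refine iSup_congr fun k => ?_
  rw [CountingPath.shift_shift, show -(t + s) + s = -t by ring, jumpFlow_pullback_add σ hs ht.le]

lemma lowerPullback_shift (hσ : 0 ≤ σ) (ht : 0 < t) (ω : CountingPath) {s : ℝ} (hs : 0 ≤ s) :
    lowerPullback σ (t + s) (CountingPath.shift s ω) = jumpFlow σ s ω (lowerPullback σ t ω) := by
  rw [lowerPullback, lowerPullback, Monotone.map_ciInf_of_continuousAt
    (continuous_jumpFlow σ hs ω).continuousAt (monotone_jumpFlow σ hs ω)
    (bddBelow_pullback hσ ht ω)]
  refine iInf_congr fun k => ?_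
  rw [CountingPath.shift_shift, show -(t + s) + s = -t by ring, jumpFlow_pullback_add σ hs ht.le]

end envelopes

lemma measurable_jumpFlow_pullback (σ t x : ℝ) :
    Measurable fun ω => jumpFlow σ t (CountingPath.shift (-t) ω) x :=
  (measurable_jumpFlow σ).comp
    (measurable_const.prodMk ((CountingPath.measurable_shift (-t)).prodMk measurable_const))

lemma measurable_upperPullback (σ t : ℝ) : Measurable (upperPullback σ t) :=
  Measurable.iSup fun k => measurable_jumpFlow_pullback σ t k

lemma measurable_lowerPullback (σ t : ℝ) : Measurable (lowerPullback σ t) :=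
  Measurable.iInf fun k => measurable_jumpFlow_pullback σ t (-k)

lemma jumpFlow_pullback_past (σ : ℝ) {t : ℝ} (ht : 0 ≤ t) (ω : CountingPath) (x : ℝ) :
    jumpFlow σ t (CountingPath.shift (-t) ω.past) x =
      jumpFlow σ t (CountingPath.shift (-t) ω) x := by
  refine jumpFlow_congr σ ht (fun s hs => ?_) x
  simp only [CountingPath.shift_apply, CountingPath.past_apply]
  rw [min_eq_left (by linarith [hs.2] : s + -t ≤ 0), min_eq_left (by linarith : -t ≤ 0)]

lemma upperPullback_past (σ : ℝ) {t : ℝ} (ht : 0 ≤ t) (ω : CountingPath) :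
    upperPullback σ t ω.past = upperPullback σ t ω := by
  simp only [upperPullback, jumpFlow_pullback_past σ ht]

lemma lowerPullback_past (σ : ℝ) {t : ℝ} (ht : 0 ≤ t) (ω : CountingPath) :
    lowerPullback σ t ω.past = lowerPullback σ t ω := by
  simp only [lowerPullback, jumpFlow_pullback_past σ ht]

lemma jumpFlow_future (σ : ℝ) {t : ℝ} (ht : 0 ≤ t) (ω : CountingPath) (x : ℝ) :
    jumpFlow σ t ω.future x = jumpFlow σ t ω x := by
  refine jumpFlow_congr σ ht (fun s hs => ?_) x
  rw [CountingPath.future_apply, max_eq_left hs.1]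

/-! ### Contraction by splitting -/

lemma Continuous.sublevel_trichotomy {f : ℝ → ℝ} (hf : Continuous f) (hm : Monotone f) (c : ℝ) :
    (∀ x, c < f x) ∨ (∀ x, f x ≤ c) ∨ ∃ h, ∀ x, f x ≤ c ↔ x ≤ h := by
  by_cases h1 : ∀ x, c < f x
  · exact Or.inl h1
  by_cases h2 : ∀ x, f x ≤ c
  · exact Or.inr (Or.inl h2)
  push Not at h1 h2
  obtain ⟨x0, hx0⟩ := h1
  obtain ⟨x1, hx1⟩ := h2
  have hne : {x | f x ≤ c}.Nonempty := ⟨x0, hx0⟩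
  have hbdd : BddAbove {x | f x ≤ c} := ⟨x1, fun y hy => by
    by_contra! h
    exact absurd ((hm h.le).trans hy) (not_le.2 hx1)⟩
  have hmem : f (sSup {x | f x ≤ c}) ≤ c :=
    (isClosed_le hf continuous_const).csSup_mem hne hbdd
  exact Or.inr (Or.inr ⟨sSup {x | f x ≤ c}, fun x =>
    ⟨fun hx => le_csSup hbdd hx, fun hx => (hm hx).trans hmem⟩⟩)

namespace IsPoissonLaw

variable {rate : ℝ≥0} {P : Measure CountingPath}

lemma measure_increment_pos (hP : IsPoissonLaw rate P) (hrate : 0 < rate) {s t : ℝ} (hst : s ≤ t)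
    (k : ℕ) (hk : s < t ∨ k = 0) : 0 < P {ω | ω.1 t - ω.1 s = k} := by
  have h := (hP.law s t hst).map_eq
  have h1 : P {ω | ω.1 t - ω.1 s = k} =
      (poissonMeasure (rate * (t - s).toNNReal)) {k} := by
    have h2 : P.map (fun ω => ω.1 t - ω.1 s) {(k : ℤ)} = P {ω | ω.1 t - ω.1 s = k} :=
      Measure.map_apply (CountingPath.measurable_increment s t) (measurableSet_singleton _)
    rw [← h2, h, Measure.map_apply .of_discrete (measurableSet_singleton _)]
    congr 1
    ext n
    simp
  rw [h1, poissonMeasure_singleton, ENNReal.ofReal_pos]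
  have h3 : 0 < ((rate * (t - s).toNNReal : ℝ≥0) : ℝ) ^ k := by
    rcases hk with hk | rfl
    · have : 0 < (t - s).toNNReal := Real.toNNReal_pos.2 (by linarith)
      have : 0 < rate * (t - s).toNNReal := by positivity
      have : (0 : ℝ) < ((rate * (t - s).toNNReal : ℝ≥0) : ℝ) := by exact_mod_cast this
      positivity
    · simp
  positivity

lemma exists_splitting (hP : IsPoissonLaw rate P) (hrate : 0 < rate) {σ : ℝ} (hσ : 0 < σ) :
    ∃ q : ℝ≥0∞, q < 1 ∧ ∀ c : ℝ, ∃ G : Set CountingPath, MeasurableSet G ∧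
      P.map CountingPath.future Gᶜ ≤ q ∧
      ∀ β ∈ G, (∀ x, c < jumpFlow σ 1 β x) ∨ (∀ x, jumpFlow σ 1 β x ≤ c) := by
  have := hP.isProbabilityMeasure
  obtain ⟨k, a, ha0, ha1, hka⟩ := exists_forall_two_lt_jumpFlow hσ
  set G₁ : Set CountingPath := {ω | ω.1 1 = 0} with hG₁
  set G₂ : Set CountingPath := {ω | ω.1 a = 0} ∩ {ω | ω.1 1 - ω.1 a = k} with hG₂
  have hm₁ : MeasurableSet G₁ := CountingPath.measurable_eval 1 (measurableSet_singleton 0)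
  have hm₂ : MeasurableSet G₂ :=
    (CountingPath.measurable_eval a (measurableSet_singleton 0)).inter
      (CountingPath.measurable_increment a 1 (measurableSet_singleton (k : ℤ)))
  have hp₁ : 0 < P G₁ := by
    have := hP.measure_increment_pos hrate zero_le_one 0 (Or.inr rfl)
    refine this.trans_eq (congrArg P ?_)
    ext ω
    simp [hG₁, ω.2.2.2]
  have hp₂ : 0 < P G₂ := by
    have hind := hP.indep.indepFun_sub_sub ha0 ha1.le
    have h := (indepFun_iff_measure_inter_preimage_eq_mul.1 hind) {0} {(k : ℤ)}
      (measurableSet_singleton _) (measurableSet_singleton _)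
    have e : G₂ = ((fun ω : CountingPath => ω.1 a) - fun ω => ω.1 0) ⁻¹' {0} ∩
        ((fun ω : CountingPath => ω.1 1) - fun ω => ω.1 a) ⁻¹' {(k : ℤ)} := by
      ext ω
      simp [hG₂, ω.2.2.2]
    rw [e]
    refine lt_of_lt_of_eq (ENNReal.mul_pos ?_ ?_) h.symm
    · have := hP.measure_increment_pos hrate ha0 0 (Or.inr rfl)
      exact this.ne'
    · exact (hP.measure_increment_pos hrate ha1.le k (Or.inl ha1)).ne'
  -- Both events see only times in `[0, 1]`, so discarding the past does not change their
  -- probability.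
  have hfut : ∀ G, MeasurableSet G → CountingPath.future ⁻¹' G = G →
      P.map CountingPath.future Gᶜ = 1 - P G := by
    intro G hG h
    rw [Measure.map_apply CountingPath.measurable_future hG.compl, Set.preimage_compl, h,
      prob_compl_eq_one_sub hG]
  refine ⟨1 - min (P G₁) (P G₂), ENNReal.sub_lt_self ENNReal.one_ne_top one_ne_zero
    (lt_min hp₁ hp₂).ne', fun c => ?_⟩
  rcases le_or_gt 2 c with hc | hc
  · refine ⟨G₁, hm₁, ?_, fun β hβ => Or.inr fun x => ?_⟩
    · rw [hfut G₁ hm₁ (by ext ω; simp [hG₁, CountingPath.future_apply])]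
      exact tsub_le_tsub_left (min_le_left _ _) _
    · have := jumpFlow_le hσ.le one_pos β x
      rw [show β.1 1 = 0 from hβ] at this
      norm_num at this
      linarith
  · refine ⟨G₂, hm₂, ?_, fun β hβ => Or.inl fun x => ?_⟩
    · rw [hfut G₂ hm₂ (by ext ω; simp [hG₂, CountingPath.future_apply, ha0])]
      exact tsub_le_tsub_left (min_le_right _ _) _
    · have h1 : β.1 a = 0 := hβ.1
      have h2 : β.1 1 - β.1 a = k := hβ.2
      exact hc.trans (hka β h1 (by linarith) x)

/-- Conditioned on the last unit of noise, straddling `c` becomes straddling a fixed level `h` by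
the earlier envelopes, which the uniform bound `M` controls; on `G` it is impossible. -/
lemma measure_crossing_add_one_le (hP : IsPoissonLaw rate P) {σ : ℝ} (hσ : 0 ≤ σ) {q M : ℝ≥0∞}
    (hq : ∀ c : ℝ, ∃ G : Set CountingPath, MeasurableSet G ∧
      P.map CountingPath.future Gᶜ ≤ q ∧
      ∀ β ∈ G, (∀ x, c < jumpFlow σ 1 β x) ∨ (∀ x, jumpFlow σ 1 β x ≤ c))
    {t : ℝ} (ht : 0 < t) (hM : ∀ c, P {ω | lowerPullback σ t ω ≤ c ∧ c < upperPullback σ t ω} ≤ M)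
    (c : ℝ) :
    P {ω | lowerPullback σ (t + 1) ω ≤ c ∧ c < upperPullback σ (t + 1) ω} ≤ q * M := by
  have := hP.isProbabilityMeasure
  obtain ⟨G, hG, hGq, hGc⟩ := hq c
  have hmE : ∀ u c, MeasurableSet {ω | lowerPullback σ u ω ≤ c ∧ c < upperPullback σ u ω} :=
    fun u c => (measurableSet_le (measurable_lowerPullback σ u) measurable_const).inter
      (measurableSet_lt measurable_const (measurable_upperPullback σ u))
  set S : Set (CountingPath × CountingPath) :=
    {p | jumpFlow σ 1 p.2 (lowerPullback σ t p.1) ≤ c ∧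
      c < jumpFlow σ 1 p.2 (upperPullback σ t p.1)} with hS
  have hSm : MeasurableSet S := by
    have h : ∀ f : CountingPath → ℝ, Measurable f →
        Measurable fun p : CountingPath × CountingPath => jumpFlow σ 1 p.2 (f p.1) := fun f hf =>
      (measurable_jumpFlow σ).comp (measurable_const.prodMk (measurable_snd.prodMk
        (hf.comp measurable_fst)))
    exact (measurableSet_le (h _ (measurable_lowerPullback σ t)) measurable_const).inter
      (measurableSet_lt measurable_const (h _ (measurable_upperPullback σ t)))
  -- Shifting by one unit makes the old envelopes functions of the past and the last flow map a
  -- function of the future.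
  have h1 : P {ω | lowerPullback σ (t + 1) ω ≤ c ∧ c < upperPullback σ (t + 1) ω} =
      P ((fun ω => (CountingPath.past ω, CountingPath.future ω)) ⁻¹' S) := by
    rw [← (hP.measurePreserving_shift 1).measure_preimage (hmE _ _).nullMeasurableSet]
    congr 1
    ext ω
    simp only [hS, Set.mem_preimage, Set.mem_ofPred_eq, upperPullback_shift hσ ht ω zero_le_one,
      lowerPullback_shift hσ ht ω zero_le_one, upperPullback_past σ ht.le,
      lowerPullback_past σ ht.le, jumpFlow_future σ zero_le_one]
  have h2 : P.map (fun ω => (CountingPath.past ω, CountingPath.future ω)) =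
      (P.map CountingPath.past).prod (P.map CountingPath.future) :=
    (indepFun_iff_map_prod_eq_prod_map_map CountingPath.measurable_past.aemeasurable
      CountingPath.measurable_future.aemeasurable).1 hP.indepFun_past_future
  have : IsProbabilityMeasure (P.map CountingPath.past) :=
    Measure.isProbabilityMeasure_map CountingPath.measurable_past.aemeasurable
  have : IsProbabilityMeasure (P.map CountingPath.future) :=
    Measure.isProbabilityMeasure_map CountingPath.measurable_future.aemeasurable
  rw [h1, ← Measure.map_apply (CountingPath.measurable_past.prodMk CountingPath.measurable_future)
    hSm, h2, Measure.prod_apply_symm hSm]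
  have hbound : ∀ β, (P.map CountingPath.past) ((fun α => (α, β)) ⁻¹' S) ≤
      Gᶜ.indicator (fun _ => M) β := by
    intro β
    have hempty : ((∀ x, c < jumpFlow σ 1 β x) ∨ (∀ x, jumpFlow σ 1 β x ≤ c)) →
        (fun α => (α, β)) ⁻¹' S = ∅ := by
      intro h
      ext α
      simp only [hS, Set.mem_preimage, Set.mem_ofPred_eq, Set.mem_empty_iff_false, iff_false,
        not_and, not_lt]
      rcases h with h | h
      · exact fun h' => absurd h' (not_le.2 (h _))
      · exact fun _ => h _
    by_cases hβ : β ∈ G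
    · rw [hempty (hGc β hβ)]; simp
    rw [Set.indicator_of_mem (show β ∈ Gᶜ from hβ)]
    rcases (continuous_jumpFlow σ zero_le_one β).sublevel_trichotomy
      (monotone_jumpFlow σ zero_le_one β) c with h | h | ⟨h, hh⟩
    · rw [hempty (Or.inl h)]; simp
    · rw [hempty (Or.inr h)]; simp
    · have : (fun α => (α, β)) ⁻¹' S =
          {α | lowerPullback σ t α ≤ h ∧ h < upperPullback σ t α} := by
        ext α
        simp only [hS, Set.mem_preimage, Set.mem_ofPred_eq, hh, ← not_le]
      rw [this, Measure.map_apply CountingPath.measurable_past (hmE t h)]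
      refine le_of_eq_of_le ?_ (hM h)
      congr 1
      ext ω
      simp only [Set.mem_preimage, Set.mem_ofPred_eq, upperPullback_past σ ht.le,
        lowerPullback_past σ ht.le]
  refine (lintegral_mono hbound).trans ?_
  rw [lintegral_indicator_const hG.compl, mul_comm]
  exact mul_le_mul_left hGq M

lemma ae_not_crossing (hP : IsPoissonLaw rate P) (hrate : 0 < rate) {σ : ℝ} (hσ : 0 < σ) (c : ℝ) :
    ∀ᵐ ω ∂P, ∃ n : ℕ, ¬ (lowerPullback σ (n + 1) ω ≤ c ∧ c < upperPullback σ (n + 1) ω) := by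
  have := hP.isProbabilityMeasure
  obtain ⟨q, hq1, hq⟩ := hP.exists_splitting hrate hσ
  have hgeo : ∀ (n : ℕ) (c : ℝ),
      P {ω | lowerPullback σ (n + 1) ω ≤ c ∧ c < upperPullback σ (n + 1) ω} ≤ q ^ n := by
    intro n
    induction n with
    | zero => intro c; simpa using prob_le_one
    | succ n ih =>
      intro c
      rw [pow_succ', Nat.cast_succ]
      exact hP.measure_crossing_add_one_le hσ.le hq (by positivity) ih c
  rw [ae_iff]
  refine le_antisymm (ge_of_tendsto' (ENNReal.tendsto_pow_atTop_nhds_zero_of_lt_one hq1)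
    fun n => (measure_mono fun ω hω => ?_).trans (hgeo n c)) zero_le
  simp only [Set.mem_ofPred_eq, not_exists, not_not] at hω
  exact hω n

end IsPoissonLaw

/-! ### The random fixed point and synchronization -/

/-- The limit of the lower pullback envelopes. -/
noncomputable def pullbackLimit (σ : ℝ) (ω : CountingPath) : ℝ :=
  ⨆ n : ℕ, lowerPullback σ (n + 1) ω

section pullbackLimit

variable {σ : ℝ}

lemma lowerPullback_le_upperPullback_of_pos (hσ : 0 ≤ σ) {s t : ℝ} (hs : 0 < s) (ht : 0 < t)
    (ω : CountingPath) : lowerPullback σ s ω ≤ upperPullback σ t ω :=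
  (lowerPullback_mono hσ hs ω (le_max_left s t)).trans
    ((lowerPullback_le_upperPullback hσ (lt_max_of_lt_left hs) ω).trans
      (upperPullback_anti hσ ht ω (le_max_right s t)))

lemma bddAbove_lowerPullback (hσ : 0 ≤ σ) (ω : CountingPath) :
    BddAbove (Set.range fun n : ℕ => lowerPullback σ (n + 1) ω) :=
  ⟨upperPullback σ 1 ω, by
    rintro _ ⟨n, rfl⟩
    exact lowerPullback_le_upperPullback_of_pos hσ (by positivity) one_pos ω⟩

lemma lowerPullback_le_pullbackLimit (hσ : 0 ≤ σ) {t : ℝ} (ht : 0 < t) (ω : CountingPath) :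
    lowerPullback σ t ω ≤ pullbackLimit σ ω := by
  obtain ⟨n, hn⟩ := exists_nat_ge t
  exact (lowerPullback_mono hσ ht ω (by linarith : t ≤ n + 1)).trans
    (le_ciSup (bddAbove_lowerPullback hσ ω) n)

lemma pullbackLimit_le_upperPullback (hσ : 0 ≤ σ) {t : ℝ} (ht : 0 < t) (ω : CountingPath) :
    pullbackLimit σ ω ≤ upperPullback σ t ω :=
  ciSup_le fun n => lowerPullback_le_upperPullback_of_pos hσ (by positivity) ht ω

lemma measurable_pullbackLimit (σ : ℝ) : Measurable (pullbackLimit σ) :=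
  Measurable.iSup fun n : ℕ => measurable_lowerPullback σ (n + 1)

/-- A continuous monotone map commutes with the supremum, and the times `n + 1 + s` and `n + 1` give
the same limit by monotonicity. -/
lemma jumpFlow_pullbackLimit (hσ : 0 ≤ σ) {s : ℝ} (hs : 0 ≤ s) (ω : CountingPath) :
    jumpFlow σ s ω (pullbackLimit σ ω) = pullbackLimit σ (CountingPath.shift s ω) := by
  have h : jumpFlow σ s ω (pullbackLimit σ ω) =
      ⨆ n : ℕ, lowerPullback σ (n + 1 + s) (CountingPath.shift s ω) := by
    rw [pullbackLimit, Monotone.map_ciSup_of_continuousAt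
      (continuous_jumpFlow σ hs ω).continuousAt (monotone_jumpFlow σ hs ω)
      (bddAbove_lowerPullback hσ ω)]
    exact iSup_congr fun n => (lowerPullback_shift hσ (by positivity) ω hs).symm
  rw [h]
  refine le_antisymm (ciSup_le fun n => lowerPullback_le_pullbackLimit hσ (by positivity) _)
    (ciSup_mono ⟨pullbackLimit σ (CountingPath.shift s ω), ?_⟩ fun n =>
      lowerPullback_mono hσ (by positivity) _ (by linarith))
  rintro _ ⟨n, rfl⟩
  exact lowerPullback_le_pullbackLimit hσ (by positivity) _

lemma infEDist_pullbackLimit_le (hσ : 0 ≤ σ) {s t : ℝ} (hs : 0 < s) (hst : s ≤ t)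
    (ω : CountingPath) (x : ℝ) :
    Metric.infEDist (jumpFlow σ t (CountingPath.shift (-t) ω) x) {pullbackLimit σ ω} ≤
      edist (upperPullback σ s ω) (lowerPullback σ s ω) := by
  have ht := hs.trans_le hst
  rw [Metric.infEDist_singleton, edist_dist, edist_dist]
  refine ENNReal.ofReal_le_ofReal ?_
  refine Real.dist_le_of_mem_Icc ⟨?_, ?_⟩ ⟨?_, ?_⟩ |>.trans (le_abs_self _)
  · exact (lowerPullback_mono hσ hs ω hst).trans (lowerPullback_le hσ ht ω x)
  · exact (le_upperPullback hσ ht ω x).trans (upperPullback_anti hσ hs ω hst)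
  · exact lowerPullback_le_pullbackLimit hσ hs ω
  · exact pullbackLimit_le_upperPullback hσ hs ω

end pullbackLimit

namespace IsPoissonLaw

variable {rate : ℝ≥0} {P : Measure CountingPath}

lemma ae_tendsto_upperPullback (hP : IsPoissonLaw rate P) (hrate : 0 < rate) {σ : ℝ} (hσ : 0 < σ) :
    ∀ᵐ ω ∂P, Tendsto (fun n : ℕ => upperPullback σ (n + 1) ω) atTop (𝓝 (pullbackLimit σ ω)) := by
  have hc : ∀ᵐ ω ∂P, ∀ c : ℚ, ∃ n : ℕ,
      ¬ (lowerPullback σ (n + 1) ω ≤ c ∧ (c : ℝ) < upperPullback σ (n + 1) ω) :=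
    ae_all_iff.2 fun c => hP.ae_not_crossing hrate hσ c
  filter_upwards [hc] with ω hω
  have hanti : Antitone fun n : ℕ => upperPullback σ (n + 1) ω := fun m n hmn =>
    upperPullback_anti hσ.le (by positivity) ω (by gcongr)
  have hbdd : BddBelow (Set.range fun n : ℕ => upperPullback σ (n + 1) ω) :=
    ⟨pullbackLimit σ ω, by
      rintro _ ⟨n, rfl⟩
      exact pullbackLimit_le_upperPullback hσ.le (by positivity) ω⟩
  have hlim := tendsto_atTop_ciInf hanti hbdd
  have hle : pullbackLimit σ ω ≤ ⨅ n : ℕ, upperPullback σ (n + 1) ω :=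
    le_ciInf fun n => pullbackLimit_le_upperPullback hσ.le (by positivity) ω
  convert hlim using 2
  refine hle.antisymm ?_
  by_contra! hlt
  -- A rational level inside the gap would be straddled for every `n`.
  obtain ⟨c, hc1, hc2⟩ := exists_rat_btwn hlt
  obtain ⟨n, hn⟩ := hω c
  exact hn ⟨(lowerPullback_le_pullbackLimit hσ.le (by positivity) ω).trans hc1.le,
    hc2.trans_le (ciInf_le hbdd n)⟩

lemma tendstoInMeasure_envelopes (hP : IsPoissonLaw rate P) (hrate : 0 < rate) {σ : ℝ}
    (hσ : 0 < σ) {ε : ℝ≥0∞} (hε : 0 < ε) :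
    Tendsto (fun n : ℕ => P {ω | ε ≤ edist (upperPullback σ (n + 1) ω)
      (lowerPullback σ (n + 1) ω)}) atTop (𝓝 0) := by
  have := hP.isProbabilityMeasure
  have h : TendstoInMeasure P
      (fun (n : ℕ) ω => upperPullback σ (n + 1) ω - lowerPullback σ (n + 1) ω) atTop
      (fun _ => 0) := by
    refine tendstoInMeasure_of_tendsto_ae (fun n => ((measurable_upperPullback σ _).sub
      (measurable_lowerPullback σ _)).aestronglyMeasurable) ?_
    filter_upwards [hP.ae_tendsto_upperPullback hrate hσ] with ω hω
    have hmono : Monotone fun n : ℕ => lowerPullback σ (n + 1) ω := fun m n hmn =>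
      lowerPullback_mono hσ.le (by positivity) ω (by gcongr)
    have := hω.sub (tendsto_atTop_ciSup hmono (bddAbove_lowerPullback hσ.le ω))
    simpa [pullbackLimit] using this
  have := h ε hε
  simpa only [edist_dist, Real.dist_eq, sub_zero] using this

lemma isWeakAttractor_pullbackLimit (hP : IsPoissonLaw rate P) (hrate : 0 < rate) {σ : ℝ}
    (hσ : 0 < σ) :
    IsWeakAttractor P CountingPath.shift (fun (t : ℝ≥0) ω x => jumpFlow σ t ω x)
      (fun ω => {pullbackLimit σ ω}) where
  isRandomCompactSet :=
    ⟨fun _ => Set.singleton_nonempty _, fun _ => isCompact_singleton, fun x => by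
      simp only [Metric.infEDist_singleton]
      exact measurable_const.edist (measurable_pullbackLimit σ)⟩
  invariant := ae_of_all _ fun ω t => by
    rw [Set.image_singleton, jumpFlow_pullbackLimit hσ.le t.coe_nonneg]
  attracts B _ ε hε := by
    -- With `n = ⌊t⌋₊ - 1`, the envelopes at time `n + 1 = ⌊t⌋₊ ≤ t` bound the distance at time `t`
    -- for all starting points at once.
    have h1 : Tendsto (fun t : ℝ≥0 => ⌊t⌋₊ - 1) atTop atTop :=
      (tendsto_sub_atTop_nat 1).comp tendsto_nat_floor_atTop
    refine tendsto_of_tendsto_of_tendsto_of_le_of_le' tendsto_const_nhds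
      ((hP.tendstoInMeasure_envelopes hrate hσ hε).comp h1) (Eventually.of_forall fun _ => zero_le)
      ?_
    filter_upwards [eventually_ge_atTop 1] with t ht
    refine measure_mono fun ω hω => ?_
    rw [Set.mem_ofPred_eq] at hω ⊢
    refine hω.trans (iSup₂_le fun x _ => ?_)
    refine infEDist_pullbackLimit_le hσ.le (by positivity) ?_ ω x
    have h2 : 1 ≤ ⌊t⌋₊ := Nat.le_floor (by simpa using ht)
    have h3 : ((⌊t⌋₊ : ℝ≥0) : ℝ) ≤ t := NNReal.coe_le_coe.2 (Nat.floor_le zero_le)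
    rw [Nat.cast_sub h2]
    simpa using h3

end IsPoissonLaw

theorem mainTheorem7 (σ : ℝ) (hσ : 0 < σ) (rate : ℝ≥0) (hrate : 0 < rate)
    (P : Measure CountingPath) (hP : IsPoissonLaw rate P) :
    (∃! φ : ℝ≥0 → CountingPath → ℝ → ℝ, IsSolutionFlow σ φ) ∧
    ∀ φ : ℝ≥0 → CountingPath → ℝ → ℝ, IsSolutionFlow σ φ →
      IsRDS P CountingPath.shift φ ∧ SynchronizationOccurs P CountingPath.shift φ := by
  refine ⟨existsUnique_isSolutionFlow σ, fun φ hφ => ?_⟩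
  obtain rfl := hφ.eq (isSolutionFlow_jumpFlow σ)
  exact ⟨isRDS_jumpFlow hP σ, _, hP.isWeakAttractor_pullbackLimit hrate hσ,
    ae_of_all _ fun ω => ⟨_, rfl⟩⟩
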